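/- **Notation.** For integers $Q,m\ge 1$ let $\mathcal A_Q(\mathbb R^m)$ be the set of unordered $Q$-tuples $\sum_{i=1}^Q[\![T_i]\!]$, $T_i\in\mathbb R^m$, with the metric $\mathcal G(\sum_i[\![R_i]\!],\sum_i[\![T_i]\!])=\min_{\sigma\in S_Q}\big(\sum_i|R_i-T_{\sigma(i)}|^2\big)^{1/2}$, and $|T|:=\mathcal G(T,Q[\![0]\!])$. $\mathcal P_k$ is the set of maps $p=\sum_{i=1}^Q[\![p_i]\!]:\mathbb R^n\to\mathcal A_Q(\mathbb R^m)$ where the components of each $p_i:\mathbb R^n\to\mathbb R^m$ are polynomials of degree at most $k$. A $Q$-valued function $u$ is differentiable at $x_0$ with derivative $Du(x_0)=\sum_i[\![A_i]\!]$ if $u(x_0)=\sum_i[\![a_i]\!]$ for some $a_i$ with $\mathcal G\big(u(x_0+h),\sum_i[\![a_i+A_ih]\!]\big)=o(|h|)$ as $h\to0$; higher derivatives are defined by iteration. For $U$ open, $u\in C^{k,\lambda}(\overline U;\mathcal A_Q(\mathbb R^m))$ means that $u,Du,\dots,D^ku$ exist on $U$, extend continuously to $\overline U$, and $D^ku$ extends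 $\lambda$-Hölder continuously to $\overline U$; $\|u\|_{k,\lambda;U}=\sum_{j\le k}\sup_U|D^ju|+[D^ku]_{\lambda;U}$. A bounded domain $U\subset\mathbb R^n$ is $A$-weighted ($A>0$) if $|U\cap B_\rho(x)|\ge A\rho^n$ for all $x\in\overline U$, $0<\rho\le\operatorname{diam}U$. **Lemma.** Let $n,m,Q\ge1$, let $\Omega\subset\mathbb R^n$ be a convex domain and let $u:\Omega\to\mathcal A_Q(\mathbb R^m)$ be measurable. Let $\Omega',\Omega''$ be open with $\overline{\Omega'}\subset\Omega''$, $\overline{\Omega''}\subset\Omega$ and $\overline{\Omega'},\overline{\Omega''}$ compact, where $\Omega'$ is a convex $A$-weighted domain, and write $\delta:=\operatorname{dist}(\Omega',\mathbb R^n\setminus\Omega'')>0$. Let $\Gamma\subset\overline\Omega$ be closed with $\Gamma\cap\overline{\Omega''}\ne\emptyset$. Let $k\in\{0,1,2,\dots\}$, $q\in[1,\infty)$, $\beta_1,\beta_2,\beta\in(0,\infty)$, $\mu\in(0,1)$, $\epsilon\in(0,1/4)$, and assume $\int_{\Omega''}|u|^q<\infty$. Suppose that for each $x_0\in\overline{\Omega''}$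 there is $P_{x_0}\in\mathcal P_k$ such that: (I) for each $x_0\in\Gamma\cap\overline{\Omega''}$ we have $\sup_\Omega|P_{x_0}|\le\beta$ and, for all $0<\sigma\le\rho/2\le\epsilon/2$, $$\sigma^{-n-kq}\int_{B_\sigma(x_0)\cap\Omega}\mathcal G(u,P_{x_0})^q\,dx\le\beta_1\Big(\frac\sigma\rho\Big)^{q\mu}\rho^{-n-kq}\int_{B_\rho(x_0)\cap\Omega}\mathcal G(u,P_{x_0})^q\,dx;$$ (II) for each $x_0\in\overline{\Omega''}\setminus\Gamma$, every $y\in\Gamma\cap\overline{\Omega''}$ and all $0<\sigma\le\rho/2<\frac12\min\{1/4,\operatorname{dist}(x_0,\Gamma)\}$, $$\sigma^{-n-kq}\int_{B_\sigma(x_0)\cap\Omega}\mathcal G(u,P_{x_0})^q\,dx\le\beta_2\Big(\frac\sigma\rho\Big)^{q\mu}\rho^{-n-kq}\int_{B_\rho(x_0)\cap\Omega}\mathcal G(u,P_y)^q\,dx.$$ Then, after modification on a null set, $u\in C^{k,\lambda}(\overline{\Omega'};\mathcal A_Q(\mathbb R^m))$ for some $\lambda=\lambda(n,m,k,q,Q,A,\beta_1,\beta_2,\epsilon,\mu,\delta)\in(0,1)$,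 with $$\|u\|_{k,\lambda;\Omega'}\le C\Big(\beta^q+\int_{\Omega''}|u|^q\Big)^{1/q},\qquad C=C(n,m,k,q,Q,A,\beta_1,\beta_2,\epsilon,\delta).$$ -/

import Mathlib

open MeasureTheory Filter Topology Metric Set
open scoped ENNReal NNReal

noncomputable section

/-! ### Unordered `Q`-tuples and the metric `𝒢` -/

/-- Two ordered `Q`-tuples are identified when they agree up to a permutation. -/
def permSetoid (Q : ℕ) (F : Type*) : Setoid (Fin Q → F) where
  r a b := ∃ σ : Equiv.Perm (Fin Q), b = a ∘ σ
  iseqv :=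
    { refl := fun _ => ⟨1, rfl⟩
      symm := by
        rintro a _ ⟨σ, rfl⟩
        exact ⟨σ⁻¹, by funext i; simp⟩
      trans := by
        rintro a _ _ ⟨σ, rfl⟩ ⟨τ, rfl⟩
        exact ⟨σ * τ, by funext i; simp⟩ }

/-- The space `𝒜_Q(F)` of unordered `Q`-tuples of elements of `F`. -/
def AQ (Q : ℕ) (F : Type*) : Type _ := Quotient (permSetoid Q F)

namespace AQ

variable {Q : ℕ} {F F' : Type*}

/-- The unordered tuple `∑ i, ⟦a i⟧`. -/
def mk (a : Fin Q → F) : AQ Q F := Quotient.mk (permSetoid Q F) a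

/-- Apply `f` to every entry: `∑ i, ⟦a i⟧ ↦ ∑ i, ⟦f (a i)⟧`. -/
def map (f : F → F') : AQ Q F → AQ Q F' :=
  Quotient.lift (fun a => mk (f ∘ a)) (by
    rintro a _ ⟨σ, rfl⟩
    exact Quotient.sound ⟨σ, rfl⟩)

variable [NormedAddCommGroup F]

/-- `(∑ i, |a i - b i| ^ 2) ^ (1/2)` for ordered tuples. -/
def tupleDist (a b : Fin Q → F) : ℝ := √(∑ i, ‖a i - b i‖ ^ 2)

/-- `min_σ (∑ i, |a i - b (σ i)| ^ 2) ^ (1/2)` (an infimum over the finite group `S_Q`). -/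
def permDist (a b : Fin Q → F) : ℝ := ⨅ σ : Equiv.Perm (Fin Q), tupleDist a (b ∘ σ)

theorem tupleDist_comp (a b : Fin Q → F) (σ : Equiv.Perm (Fin Q)) :
    tupleDist (a ∘ σ) (b ∘ σ) = tupleDist a b := by
  unfold tupleDist
  congr 1
  exact Equiv.sum_comp σ (fun i => ‖a i - b i‖ ^ 2)

theorem tupleDist_comm (a b : Fin Q → F) : tupleDist a b = tupleDist b a := by
  unfold tupleDist
  simp only [norm_sub_rev]

theorem tupleDist_nonneg (a b : Fin Q → F) : 0 ≤ tupleDist a b := Real.sqrt_nonneg _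

theorem tupleDist_eq_dist (a b : Fin Q → F) :
    tupleDist a b = dist (WithLp.toLp 2 a : PiLp 2 fun _ : Fin Q => F) (WithLp.toLp 2 b) := by
  rw [dist_eq_norm, PiLp.norm_eq_of_L2]
  rfl

theorem tupleDist_triangle (a b c : Fin Q → F) :
    tupleDist a c ≤ tupleDist a b + tupleDist b c := by
  simp only [tupleDist_eq_dist]
  exact dist_triangle _ _ _

theorem permDist_le (a b : Fin Q → F) (σ : Equiv.Perm (Fin Q)) :
    permDist a b ≤ tupleDist a (b ∘ σ) :=
  ciInf_le ⟨0, by rintro _ ⟨τ, rfl⟩; exact tupleDist_nonneg _ _⟩ σ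

theorem exists_permDist_eq (a b : Fin Q → F) :
    ∃ σ : Equiv.Perm (Fin Q), tupleDist a (b ∘ σ) = permDist a b :=
  exists_eq_ciInf_of_finite

theorem permDist_comm (a b : Fin Q → F) : permDist a b = permDist b a := by
  have key : ∀ a b : Fin Q → F, permDist a b ≤ permDist b a := by
    intro a b
    obtain ⟨σ, hσ⟩ := exists_permDist_eq b a
    rw [← hσ]
    refine (permDist_le a b σ⁻¹).trans (le_of_eq ?_)
    rw [tupleDist_comm b, ← tupleDist_comp a (b ∘ _) σ]
    congr 1
    funext i
    simp
  exact le_antisymm (key a b) (key b a)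

theorem permDist_triangle (a b c : Fin Q → F) :
    permDist a c ≤ permDist a b + permDist b c := by
  obtain ⟨σ, hσ⟩ := exists_permDist_eq a b
  obtain ⟨τ, hτ⟩ := exists_permDist_eq b c
  rw [← hσ, ← hτ, ← tupleDist_comp b (c ∘ τ) σ]
  exact (permDist_le a c (τ * σ)).trans (tupleDist_triangle _ _ _)

theorem permDist_comp_right (a b : Fin Q → F) (τ : Equiv.Perm (Fin Q)) :
    permDist a (b ∘ τ) = permDist a b := by
  apply le_antisymm
  · obtain ⟨σ, hσ⟩ := exists_permDist_eq a b
    rw [← hσ]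
    refine (permDist_le a (b ∘ τ) (τ⁻¹ * σ)).trans (le_of_eq ?_)
    congr 1
    funext i
    simp
  · obtain ⟨σ, hσ⟩ := exists_permDist_eq a (b ∘ τ)
    rw [← hσ]
    exact permDist_le a b (τ * σ)

/-- The metric `𝒢` on unordered `Q`-tuples. -/
def G : AQ Q F → AQ Q F → ℝ :=
  Quotient.lift₂ permDist (by
    rintro a b _ _ ⟨σ, rfl⟩ ⟨τ, rfl⟩
    rw [permDist_comp_right, permDist_comm (a ∘ σ), permDist_comp_right, permDist_comm])

theorem G_mk (a b : Fin Q → F) : G (mk a) (mk b) = permDist a b := rfl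

instance : MetricSpace (AQ Q F) where
  dist := G
  dist_self S := by
    induction S using Quotient.inductionOn with | _ a
    refine le_antisymm ((permDist_le a a 1).trans (le_of_eq ?_))
      (Real.iInf_nonneg fun _ => tupleDist_nonneg _ _)
    simp [tupleDist]
  dist_comm S T := by
    induction S, T using Quotient.inductionOn₂ with | _ a b
    exact permDist_comm a b
  dist_triangle S T U := by
    induction S, T, U using Quotient.inductionOn₃ with | _ a b c
    exact permDist_triangle a b c
  eq_of_dist_eq_zero := by
    intro S T
    induction S, T using Quotient.inductionOn₂ with | _ a b
    intro h
    obtain ⟨σ, hσ⟩ := exists_permDist_eq a b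
    have h0 : tupleDist a (b ∘ σ) = 0 := hσ.trans h
    rw [tupleDist_eq_dist, dist_eq_zero] at h0
    have h1 : a = b ∘ σ := congrArg WithLp.ofLp h0
    exact Quotient.sound ⟨σ⁻¹, by rw [h1]; funext i; simp⟩

/-- `|T| = 𝒢(T, Q⟦0⟧)`. -/
def mag (T : AQ Q F) : ℝ := G T (mk fun _ => 0)

end AQ

/-! ### Differentiability and the classes `C^{k,α}` of `Q`-valued functions -/

/-- `u` is differentiable at `x₀` with derivative `u' = ∑ i, ⟦A i⟧`, the matrix `A i` being attached
to the value `a i` of `u(x₀) = ∑ i, ⟦a i⟧`. -/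
def HasQDerivAt {Q : ℕ} {E F : Type*} [NormedAddCommGroup E] [NormedSpace ℝ E]
    [NormedAddCommGroup F] [NormedSpace ℝ F]
    (u : E → AQ Q F) (u' : AQ Q (E →L[ℝ] F)) (x₀ : E) : Prop :=
  ∃ (a : Fin Q → F) (A : Fin Q → E →L[ℝ] F), u x₀ = AQ.mk a ∧ u' = AQ.mk A ∧
    Tendsto (fun h : E => AQ.G (u (x₀ + h)) (AQ.mk fun i => a i + A i h) / ‖h‖) (𝓝[≠] 0) (𝓝 0)

/-- On the open set `U`, `v 0, …, v k` are the successive derivatives `u, Du, …, D^k u` of the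
`Q`-valued function `u`; the `j`-th one takes values in `Q`-tuples of `j`-linear maps. -/
structure HasQDerivsOn {Q : ℕ} {E F : Type*} [NormedAddCommGroup E] [NormedSpace ℝ E]
    [NormedAddCommGroup F] [NormedSpace ℝ F] (k : ℕ) (u : E → AQ Q F)
    (v : (j : ℕ) → E → AQ Q (E [×j]→L[ℝ] F)) (U : Set E) : Prop where
  zero_eq : ∀ x ∈ U, v 0 x = (u x).map (ContinuousMultilinearMap.uncurry0 ℝ E)
  deriv : ∀ j < k, ∀ x ∈ U,
    HasQDerivAt (v j) ((v (j + 1) x).map ContinuousMultilinearMap.curryLeft) x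

/-- `u ∈ C^{k,α}(closure U; 𝒜_Q(F))`: on `U` the derivatives up to order `k` exist, they extend
continuously to `closure U`, and the one of order `k` extends as an `α`-Hölder function. -/
def MemQHolder {Q : ℕ} {E F : Type*} [NormedAddCommGroup E] [NormedSpace ℝ E]
    [NormedAddCommGroup F] [NormedSpace ℝ F] (k : ℕ) (α : ℝ≥0) (U : Set E)
    (u : E → AQ Q F) : Prop :=
  ∃ v : (j : ℕ) → E → AQ Q (E [×j]→L[ℝ] F), HasQDerivsOn k u v U ∧
    (∀ j ≤ k, ContinuousOn (v j) (closure U)) ∧ ∃ K : ℝ≥0, HolderOnWith K α (v k) (closure U)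

/-- The norm `‖u‖_{k,α;U} = ∑_{j ≤ k} sup_U |D^j u| + [D^k u]_{α;U}`, with value `∞` if the
derivatives do not exist. (They are unique on an open set, so that the infimum only serves to
name them.) -/
def qHolderNorm {Q : ℕ} {E F : Type*} [NormedAddCommGroup E] [NormedSpace ℝ E]
    [NormedAddCommGroup F] [NormedSpace ℝ F] (k : ℕ) (α : ℝ≥0) (U : Set E)
    (u : E → AQ Q F) : ℝ≥0∞ :=
  ⨅ (v : (j : ℕ) → E → AQ Q (E [×j]→L[ℝ] F)) (_ : HasQDerivsOn k u v U),
    (∑ j ∈ Finset.range (k + 1), ⨆ x ∈ U, ENNReal.ofReal (AQ.mag (v j x))) +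
      ⨆ (x ∈ U) (y ∈ U) (_ : x ≠ y),
        ENNReal.ofReal (AQ.G (v k x) (v k y) / dist x y ^ (α : ℝ))

/-! ### `Q`-valued polynomials and `A`-weighted domains -/

/-- `p : ℝⁿ → 𝒜_Q(ℝᵐ)` is a `Q`-valued polynomial of degree at most `k`. -/
def IsQPoly {n m Q : ℕ} (k : ℕ)
    (p : EuclideanSpace ℝ (Fin n) → AQ Q (EuclideanSpace ℝ (Fin m))) : Prop :=
  ∃ c : Fin Q → Fin m → MvPolynomial (Fin n) ℝ, (∀ i j, (c i j).totalDegree ≤ k) ∧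
    ∀ x, p x = AQ.mk fun i => WithLp.toLp 2 fun j => MvPolynomial.eval (fun l => x l) (c i j)

/-- `Ω` is a bounded domain with `|Ω ∩ B_ρ(x)| ≥ A ρⁿ` for `x ∈ closure Ω`, `0 < ρ ≤ diam Ω`. -/
structure IsWeightedDomain {n : ℕ} (A : ℝ) (Ω : Set (EuclideanSpace ℝ (Fin n))) : Prop where
  isOpen : IsOpen Ω
  isConnected : IsConnected Ω
  isBounded : Bornology.IsBounded Ω
  le_volume : ∀ x ∈ closure Ω, ∀ ρ : ℝ, 0 < ρ → ρ ≤ Metric.diam Ω →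
    ENNReal.ofReal (A * ρ ^ n) ≤ volume (Ω ∩ ball x ρ)

/-- The distance `inf {|x - y| : x ∈ S, y ∈ T}` between two (non-empty) sets. -/
def setDist {E : Type*} [MetricSpace E] (S T : Set E) : ℝ :=
  sInf {r : ℝ | ∃ x ∈ S, ∃ y ∈ T, r = dist x y}

end

/-! This is a Campanato argument. Hypotheses (I) and (II) are combined into one decay estimate: at
every `x` with `ball x δ ⊆ Ω''` and every small scale `σ`, the integral of `𝒢(u, P_x)^q` over
`B_σ(x)` is at most a constant times `(β^q + ∫|u|^q) σ^(n+kq+qμ)`. Comparing `P_x` and `P_y` through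
`u` on a ball of radius `|x - y|` then shows that their derivatives of order `j` at `y` differ by
`O(|x - y|^(k+μ-j))`. These are the Whitney compatibility conditions, so `x ↦ P_x(x)` is of class
`C^{k,μ}`, its derivatives being the tuples of derivatives of the sheets of `P_x` at `x`. Averages
of `𝒢(u, P_x(x))^q` over shrinking balls tend to zero, so this function agrees with `u` almost
everywhere.

The multivalued difficulty is that the permutation realising `𝒢` changes from point to point, while
derivatives can only be compared once the sheets are matched once and for all.
`exists_perm_polynomial_close` removes it: for polynomials of bounded degree, `L^q` closeness on a
ball yields one permutation under which coefficients, hence derivatives and growth at infinity, are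
close. It rests on compactness and on the fact that finitely many nonzero polynomials have a common
non-zero.

For the decay at `x ∉ Γ`, put `d = dist(x, Γ)` and take `y ∈ Γ` with `|x - y| < 2d`. Scales below
`d/4` follow from (II) and the decay at `y`. At larger scales `P_x` is compared with `P_y` on
`B_{d/4}(x)`, and polynomial growth carries the comparison out to `B_σ(x)`. All constants are
estimated with `μ` replaced by 1 where it enters an exponent, so that they do not depend on `μ`; the
Hölder exponent obtained is `μ` itself. -/

noncomputable section

/-! ### Polynomial maps in coordinates -/

/-- The exponents of total degree at most `k` in `n` variables. -/
def polyExponents (n k : ℕ) : Finset (Fin n →₀ ℕ) :=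
  (Finset.Iic (Finsupp.equivFunOnFinite.symm fun _ => k)).filter fun s => s.degree ≤ k

theorem mem_polyExponents {n k : ℕ} {s : Fin n →₀ ℕ} : s ∈ polyExponents n k ↔ s.degree ≤ k := by
  simp only [polyExponents, Finset.mem_filter, Finset.mem_Iic, and_iff_right_iff_imp]
  intro h i
  exact (Finsupp.le_degree i s).trans h

/-- The space of coefficients of polynomial maps `ℝⁿ → ℝᵐ` of degree at most `k`. -/
abbrev PolyCoeff (n m k : ℕ) := polyExponents n k → EuclideanSpace ℝ (Fin m)

/-- The polynomial map with given coefficients. -/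
def polyMap {n m k : ℕ} (c : PolyCoeff n m k) (x : EuclideanSpace ℝ (Fin n)) :
    EuclideanSpace ℝ (Fin m) :=
  ∑ s, (∏ i, x i ^ s.1 i) • c s

/-- `f : ℝⁿ → ℝᵐ` has polynomial components of degree at most `k`. -/
def IsPolyMap {n m : ℕ} (k : ℕ) (f : EuclideanSpace ℝ (Fin n) → EuclideanSpace ℝ (Fin m)) :
    Prop :=
  ∃ c : Fin m → MvPolynomial (Fin n) ℝ, (∀ j, (c j).totalDegree ≤ k) ∧
    ∀ x, f x = WithLp.toLp 2 fun j => MvPolynomial.eval (fun l => x l) (c j)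

variable {n m k Q : ℕ}

theorem IsPolyMap.exists_coeff {f : EuclideanSpace ℝ (Fin n) → EuclideanSpace ℝ (Fin m)}
    (hf : IsPolyMap k f) : ∃ c : PolyCoeff n m k, f = polyMap c := by
  obtain ⟨c, hc, hfc⟩ := hf
  refine ⟨fun s => WithLp.toLp 2 fun j => (c j).coeff s.1, ?_⟩
  funext x
  rw [hfc]
  ext j
  simp only [polyMap, WithLp.ofLp_sum, WithLp.ofLp_smul, Finset.sum_apply, Pi.smul_apply,
    smul_eq_mul]
  rw [MvPolynomial.eval_eq', Finset.sum_coe_sort (polyExponents n k)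
    (fun s => (∏ i, x i ^ s i) * (c j).coeff s)]
  have hsub : (c j).support ⊆ polyExponents n k := by
    intro s hs
    rw [mem_polyExponents]
    refine le_trans ?_ ((MvPolynomial.le_totalDegree hs).trans (hc j))
    rw [Finsupp.degree_eq_sum, Finsupp.sum_fintype _ _ (fun _ => rfl)]
  rw [Finset.sum_subset hsub]
  · exact Finset.sum_congr rfl fun s _ => mul_comm _ _
  · intro s _ hs
    rw [MvPolynomial.notMem_support_iff.1 hs, zero_mul]

theorem isPolyMap_zero :
    IsPolyMap k (fun _ => 0 : EuclideanSpace ℝ (Fin n) → EuclideanSpace ℝ (Fin m)) :=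
  ⟨fun _ => 0, fun _ => by simp, fun x => by ext j; simp⟩

/-- Each monomial turns into a product of powers of polynomials of degree at most one, with the same
exponents. -/
theorem totalDegree_bind₁_affine_le (p : MvPolynomial (Fin n) ℝ) (a : Fin n → ℝ) (r : ℝ) :
    (MvPolynomial.bind₁ (fun l => MvPolynomial.C (a l) + MvPolynomial.C r * MvPolynomial.X l)
      p).totalDegree ≤ p.totalDegree := by
  classical
  conv_lhs => rw [p.as_sum, map_sum]
  refine MvPolynomial.totalDegree_finsetSum_le fun s hs => ?_
  rw [MvPolynomial.bind₁_monomial]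
  refine (MvPolynomial.totalDegree_mul _ _).trans ?_
  rw [MvPolynomial.totalDegree_C, zero_add]
  refine (MvPolynomial.totalDegree_finsetProd _ _).trans ?_
  refine le_trans (Finset.sum_le_sum (g := fun i => s i) fun i _ => ?_)
    (MvPolynomial.le_totalDegree hs)
  refine (MvPolynomial.totalDegree_pow _ _).trans ?_
  have : (MvPolynomial.C (a i) + MvPolynomial.C r * MvPolynomial.X i :
      MvPolynomial (Fin n) ℝ).totalDegree ≤ 1 := by
    refine (MvPolynomial.totalDegree_add _ _).trans (max_le (by simp) ?_)
    refine (MvPolynomial.totalDegree_mul _ _).trans ?_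
    simp
  nlinarith [Nat.zero_le (s i)]

theorem IsPolyMap.comp_affine {f : EuclideanSpace ℝ (Fin n) → EuclideanSpace ℝ (Fin m)}
    (hf : IsPolyMap k f) (x₀ : EuclideanSpace ℝ (Fin n)) (r : ℝ) :
    IsPolyMap k fun h => f (x₀ + r • h) := by
  obtain ⟨c, hc, hfc⟩ := hf
  refine ⟨fun j => MvPolynomial.bind₁
    (fun l => MvPolynomial.C (x₀ l) + MvPolynomial.C r * MvPolynomial.X l) (c j),
    fun j => (totalDegree_bind₁_affine_le _ _ _).trans (hc j), fun x => ?_⟩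
  simp only [hfc]
  ext j
  simp only [MvPolynomial.eval, MvPolynomial.eval₂Hom_bind₁]
  congr 1
  congr 1
  funext l
  simp

theorem polyMap_sub (a b : PolyCoeff n m k) : polyMap (a - b) = polyMap a - polyMap b := by
  funext x
  simp [polyMap, smul_sub]

theorem polyMap_smul (t : ℝ) (a : PolyCoeff n m k) (x : EuclideanSpace ℝ (Fin n)) :
    polyMap (t • a) x = t • polyMap a x := by
  simp only [polyMap, Pi.smul_apply, Finset.smul_sum]
  exact Finset.sum_congr rfl fun s _ => smul_comm _ _ _

theorem contDiff_polyMap (c : PolyCoeff n m k) {N : WithTop ℕ∞} : ContDiff ℝ N (polyMap c) := by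
  unfold polyMap
  fun_prop

theorem IsPolyMap.contDiff {f : EuclideanSpace ℝ (Fin n) → EuclideanSpace ℝ (Fin m)}
    (hf : IsPolyMap k f) {N : WithTop ℕ∞} : ContDiff ℝ N f := by
  obtain ⟨c, rfl⟩ := hf.exists_coeff
  exact contDiff_polyMap c

theorem continuous_polyMap_uncurry :
    Continuous fun z : PolyCoeff n m k × EuclideanSpace ℝ (Fin n) => polyMap z.1 z.2 := by
  unfold polyMap
  fun_prop

/-- The growth of order `k` is what later carries an estimate from a small ball to a larger
concentric one. -/
theorem norm_polyMap_le (c : PolyCoeff n m k) (x : EuclideanSpace ℝ (Fin n)) :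
    ‖polyMap c x‖ ≤ (Fintype.card (polyExponents n k) : ℝ) * ‖c‖ * max 1 ‖x‖ ^ k := by
  unfold polyMap
  refine (norm_sum_le _ _).trans ?_
  rw [mul_assoc, ← nsmul_eq_mul]
  refine Finset.sum_le_card_nsmul _ _ _ fun s _ => ?_
  rw [norm_smul, mul_comm]
  refine mul_le_mul (norm_le_pi_norm c s) ?_ (norm_nonneg _) (norm_nonneg _)
  rw [norm_prod]
  calc ∏ i, ‖x i ^ s.1 i‖ ≤ ∏ i, max 1 ‖x‖ ^ s.1 i := by
        refine Finset.prod_le_prod (fun _ _ => norm_nonneg _) fun i _ => ?_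
        rw [norm_pow]
        exact pow_le_pow_left₀ (norm_nonneg _)
          ((PiLp.norm_apply_le x i).trans (le_max_right _ _)) _
    _ = max 1 ‖x‖ ^ s.1.degree := by
        rw [Finset.prod_pow_eq_pow_sum, Finsupp.degree_eq_sum]
    _ ≤ max 1 ‖x‖ ^ k := pow_le_pow_right₀ (le_max_left _ _) (mem_polyExponents.1 s.2)

theorem exists_norm_iteratedFDeriv_polyMap_le (n m k j : ℕ) :
    ∃ C : ℝ, 0 ≤ C ∧ ∀ c : PolyCoeff n m k, ∀ x ∈ closedBall (0 : EuclideanSpace ℝ (Fin n)) 1,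
      ‖iteratedFDeriv ℝ j (polyMap c) x‖ ≤ C * ‖c‖ := by
  have hmono : ∀ s : polyExponents n k, ContDiff ℝ (⊤ : ℕ∞)
      (fun x : EuclideanSpace ℝ (Fin n) => ∏ i, x i ^ s.1 i) := fun s => by fun_prop
  have hb : ∀ s : polyExponents n k, ∃ C : ℝ, ∀ x ∈ closedBall (0 : EuclideanSpace ℝ (Fin n)) 1,
      ‖iteratedFDeriv ℝ j (fun x : EuclideanSpace ℝ (Fin n) => ∏ i, x i ^ s.1 i) x‖ ≤ C :=
    fun s => (isCompact_closedBall 0 1).exists_bound_of_continuousOn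
      ((hmono s).continuous_iteratedFDeriv (by exact_mod_cast le_top)).continuousOn
  choose B hB using hb
  have h0 : (0 : EuclideanSpace ℝ (Fin n)) ∈ closedBall (0 : EuclideanSpace ℝ (Fin n)) 1 := by simp
  refine ⟨∑ s, B s, Finset.sum_nonneg fun s _ => (norm_nonneg _).trans (hB s 0 h0),
    fun c x hx => ?_⟩
  have hsum : iteratedFDeriv ℝ j (polyMap c) x = ∑ s, iteratedFDeriv ℝ j
      (fun x : EuclideanSpace ℝ (Fin n) => (∏ i, x i ^ s.1 i) • c s) x := by
    unfold polyMap
    rw [iteratedFDeriv_fun_sum_apply (fun s _ => ContDiff.contDiffAt (by fun_prop))]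
  rw [hsum, Finset.sum_mul]
  refine (norm_sum_le _ _).trans (Finset.sum_le_sum fun s _ => ?_)
  set L : ℝ →L[ℝ] EuclideanSpace ℝ (Fin m) := ContinuousLinearMap.toSpanSingleton ℝ (c s)
  have hL : (fun x : EuclideanSpace ℝ (Fin n) => (∏ i, x i ^ s.1 i) • c s) =
      L ∘ fun x => ∏ i, x i ^ s.1 i := by
    funext y; simp [L]
  rw [hL]
  refine (L.norm_iteratedFDeriv_comp_left (hmono s).contDiffAt
    (by exact_mod_cast le_top)).trans ?_
  rw [mul_comm, ContinuousLinearMap.norm_toSpanSingleton]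
  exact mul_le_mul (hB s x hx) (norm_le_pi_norm c s) (norm_nonneg _)
    ((norm_nonneg _).trans (hB s 0 h0))

/-- Finitely many non-zero polynomial maps have a common non-zero on each ball around `0`. -/
theorem exists_forall_polyMap_ne_zero {ι : Type*} [Finite ι] (c : ι → PolyCoeff n m k)
    (hc : ∀ i, c i ≠ 0) {r : ℝ} (hr : 0 < r) :
    ∃ x ∈ ball (0 : EuclideanSpace ℝ (Fin n)) r, ∀ i, polyMap (c i) x ≠ 0 := by
  classical
  have := Fintype.ofFinite ι
  have h1 : ∀ i, ∃ s : polyExponents n k, ∃ j : Fin m, c i s j ≠ 0 := by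
    intro i
    by_contra! h
    exact hc i (funext fun s => by ext j; exact h s j)
  choose s j hsj using h1
  -- One nonzero scalar component is kept for each map. Their product is a nonzero polynomial, so it
  -- cannot vanish on a product of infinite sets such as a small cube around 0.
  let p : ι → MvPolynomial (Fin n) ℝ := fun i =>
    ∑ t : polyExponents n k, MvPolynomial.monomial t.1 (c i t (j i))
  have hp : ∀ i, p i ≠ 0 := by
    intro i h
    apply hsj i
    have h2 := congrArg (MvPolynomial.coeff (s i).1) h
    simp only [p, MvPolynomial.coeff_sum, MvPolynomial.coeff_monomial,
      MvPolynomial.coeff_zero] at h2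
    rwa [Finset.sum_eq_single (s i), if_pos rfl] at h2
    · intro t _ ht
      exact if_neg fun h => ht (Subtype.ext h)
    · simp
  have heval : ∀ i (x : EuclideanSpace ℝ (Fin n)),
      MvPolynomial.eval (fun l => x l) (p i) = polyMap (c i) x (j i) := by
    intro i x
    simp only [p, polyMap, map_sum, WithLp.ofLp_sum, WithLp.ofLp_smul, Finset.sum_apply,
      Pi.smul_apply, smul_eq_mul, MvPolynomial.eval_monomial]
    refine Finset.sum_congr rfl fun t _ => ?_
    rw [mul_comm, Finsupp.prod_fintype _ _ (fun _ => pow_zero _)]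
  have hprod : ∏ i, p i ≠ 0 := Finset.prod_ne_zero_iff.2 fun i _ => hp i
  have hopen : IsOpen ((fun y : Fin n → ℝ => (WithLp.toLp 2 y : EuclideanSpace ℝ (Fin n))) ⁻¹'
      ball 0 r) := isOpen_ball.preimage (PiLp.continuous_toLp 2 _)
  obtain ⟨η, hη, hsub⟩ := Metric.isOpen_iff.1 hopen 0 (by simp [hr])
  by_contra! hcon
  apply hprod
  refine MvPolynomial.funext_set (fun _ => ball (0 : ℝ) η)
    (fun _ => infinite_of_mem_nhds (0 : ℝ) (ball_mem_nhds 0 hη)) fun y hy => ?_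
  have hy' : y ∈ ball (0 : Fin n → ℝ) η := by
    rw [mem_ball, dist_pi_lt_iff hη]
    exact fun i => hy i (mem_univ i)
  obtain ⟨i, hi⟩ := hcon _ (hsub hy')
  rw [map_prod, map_zero]
  refine Finset.prod_eq_zero (Finset.mem_univ i) ?_
  have := heval i (WithLp.toLp 2 y)
  rw [hi] at this
  simpa using this

/-! ### Comparison of `Q`-valued polynomials -/

/-- The integral is continuous in `g`, which ranges over a product of unit spheres in finite
dimension, so a minimum is attained. It is positive because the minimum over `σ` is positive
wherever one nonzero sheet for each `σ` is nonzero simultaneously. -/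
theorem exists_le_integral_min_polyMap (n m Q k : ℕ) {q : ℝ} (hq : 0 < q) :
    ∃ c : ℝ, 0 < c ∧ ∀ g : Equiv.Perm (Fin Q) → Fin Q → PolyCoeff n m k, (∀ σ, ‖g σ‖ = 1) →
      c ≤ ∫ x in closedBall (0 : EuclideanSpace ℝ (Fin n)) (1 / 2),
        (Finset.univ.inf' Finset.univ_nonempty fun σ => ‖fun i => polyMap (g σ i) x‖) ^ q := by
  classical
  let φ : (Equiv.Perm (Fin Q) → Fin Q → PolyCoeff n m k) → EuclideanSpace ℝ (Fin n) → ℝ :=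
    fun g x => (Finset.univ.inf' Finset.univ_nonempty fun σ => ‖fun i => polyMap (g σ i) x‖) ^ q
  have hφ : Continuous φ.uncurry := by
    refine Continuous.rpow_const ?_ (fun _ => Or.inr hq.le)
    refine Continuous.finset_inf'_apply _ fun σ _ => ?_
    refine Continuous.norm (continuous_pi fun i => ?_)
    exact continuous_polyMap_uncurry.comp
      (f := fun z : (Equiv.Perm (Fin Q) → Fin Q → PolyCoeff n m k) × EuclideanSpace ℝ (Fin n) =>
        (z.1 σ i, z.2)) (by fun_prop)
  have hφ0 : ∀ g x, 0 ≤ φ g x := fun g x => by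
    refine Real.rpow_nonneg ?_ _
    exact (Finset.le_inf'_iff _ _).2 fun σ _ => norm_nonneg _
  let Φ := fun g => ∫ x in closedBall (0 : EuclideanSpace ℝ (Fin n)) (1 / 2), φ g x
  have hΦ : Continuous Φ :=
    continuous_parametric_integral_of_continuous hφ (isCompact_closedBall _ _)
  let S : Set (Equiv.Perm (Fin Q) → Fin Q → PolyCoeff n m k) := {g | ∀ σ, ‖g σ‖ = 1}
  have hS : IsCompact S := by
    have : S = Set.pi univ fun _ => sphere (0 : Fin Q → PolyCoeff n m k) 1 := by
      ext g; simp [S]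
    rw [this]
    exact isCompact_univ_pi fun _ => isCompact_sphere _ _
  -- There are no unit vectors when the coefficient space is trivial.
  rcases S.eq_empty_or_nonempty with hSe | hSn
  · refine ⟨1, one_pos, fun g hg => absurd (show g ∈ S from hg) ?_⟩
    simp [hSe]
  obtain ⟨g₀, hg₀, hmin⟩ := hS.exists_isMinOn hSn hΦ.continuousOn
  refine ⟨Φ g₀, ?_, fun g hg => hmin hg⟩
  have hne : ∀ σ, ∃ i, g₀ σ i ≠ 0 := by
    intro σ
    by_contra! h
    have h1 := hg₀ σ
    rw [show g₀ σ = 0 from funext h, norm_zero] at h1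
    exact zero_ne_one h1
  choose i hi using hne
  obtain ⟨x, hx, hx0⟩ := exists_forall_polyMap_ne_zero (fun σ => g₀ σ (i σ)) hi
    (show (0 : ℝ) < 1 / 2 by norm_num)
  have hpos : 0 < φ g₀ x := by
    refine Real.rpow_pos_of_pos ((Finset.lt_inf'_iff _).2 fun σ _ => ?_) _
    exact (norm_pos_iff.2 (hx0 σ)).trans_le
      (norm_le_pi_norm (fun j => polyMap (g₀ σ j) x) (i σ))
  have hcont : Continuous (φ g₀) := hφ.comp (f := fun x => (g₀, x)) (by fun_prop)
  rw [setIntegral_pos_iff_support_of_nonneg_ae (ae_of_all _ (hφ0 g₀))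
    (hcont.continuousOn.integrableOn_compact (isCompact_closedBall _ _))]
  have hopen : IsOpen (Function.support (φ g₀) ∩ ball 0 (1 / 2)) :=
    hcont.isOpen_support.inter isOpen_ball
  refine (hopen.measure_pos volume ⟨x, hpos.ne', hx⟩).trans_le (measure_mono ?_)
  exact inter_subset_inter_right _ ball_subset_closedBall

theorem AQ.norm_le_tupleDist {F : Type*} [NormedAddCommGroup F] (a b : Fin Q → F) :
    ‖fun i => a i - b i‖ ≤ AQ.tupleDist a b := by
  refine (pi_norm_le_iff_of_nonneg (AQ.tupleDist_nonneg _ _)).2 fun i => ?_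
  refine Real.le_sqrt_of_sq_le ?_
  exact Finset.single_le_sum (f := fun i => ‖a i - b i‖ ^ 2) (fun _ _ => by positivity)
    (Finset.mem_univ i)

/-- The permutation chosen minimises the norm of the coefficient difference `a - b ∘ σ`. Whichever
`σ` is optimal at a given `x`, its difference is at least as large as the minimal one, and after
normalisation the compactness bound applies to all `σ` at once. -/
theorem exists_perm_coeff_le (n m Q k : ℕ) {q : ℝ} (hq : 0 < q) :
    ∃ c : ℝ, 0 < c ∧ ∀ a b : Fin Q → PolyCoeff n m k, ∃ σ : Equiv.Perm (Fin Q), ∀ i,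
      ENNReal.ofReal (c * ‖a i - b (σ i)‖ ^ q) ≤
        ∫⁻ x in ball (0 : EuclideanSpace ℝ (Fin n)) 1, ENNReal.ofReal
          (AQ.permDist (fun i => polyMap (a i) x) (fun i => polyMap (b i) x) ^ q) := by
  classical
  obtain ⟨c, hc, hcg⟩ := exists_le_integral_min_polyMap n m Q k hq
  refine ⟨c, hc, fun a b => ?_⟩
  let f : Equiv.Perm (Fin Q) → Fin Q → PolyCoeff n m k := fun σ i => a i - b (σ i)
  -- Normalisation needs nonzero differences; if one vanishes, its permutation matches the sheets
  -- exactly.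
  by_cases h0 : ∃ σ, f σ = 0
  · obtain ⟨σ, hσ⟩ := h0
    refine ⟨σ, fun i => ?_⟩
    have : a i - b (σ i) = 0 := congrFun hσ i
    simp [this, Real.zero_rpow hq.ne']
  push Not at h0
  obtain ⟨σ₀, hσ₀⟩ := Finite.exists_min fun σ => ‖f σ‖
  refine ⟨σ₀, fun i => ?_⟩
  have hf0 : 0 < ‖f σ₀‖ := norm_pos_iff.2 (h0 σ₀)
  let g := fun σ => ‖f σ‖⁻¹ • f σ
  have hg : ∀ σ, ‖g σ‖ = 1 := fun σ => by
    simp only [g]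
    rw [norm_smul, norm_inv, norm_norm, inv_mul_cancel₀ (norm_ne_zero_iff.2 (h0 σ))]
  let N : EuclideanSpace ℝ (Fin n) → ℝ := fun x =>
    Finset.univ.inf' Finset.univ_nonempty fun σ => ‖fun i => polyMap (g σ i) x‖
  have hN0 : ∀ x, 0 ≤ N x := fun x => (Finset.le_inf'_iff _ _).2 fun σ _ => norm_nonneg _
  have hNc : Continuous N := by
    refine Continuous.finset_inf'_apply _ fun σ _ => ?_
    exact Continuous.norm (continuous_pi fun i => (contDiff_polyMap (N := 0) _).continuous)
  have hNq : Continuous fun x => N x ^ q := hNc.rpow_const fun _ => Or.inr hq.le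
  have hle : ∀ x, ‖f σ₀‖ * N x ≤
      AQ.permDist (fun i => polyMap (a i) x) (fun i => polyMap (b i) x) := by
    intro x
    obtain ⟨σ, hσ⟩ := AQ.exists_permDist_eq (fun i => polyMap (a i) x) fun i => polyMap (b i) x
    rw [← hσ]
    refine le_trans ?_ (AQ.norm_le_tupleDist _ _)
    have h1 : (fun i => polyMap (a i) x - ((fun i => polyMap (b i) x) ∘ σ) i) =
        ‖f σ‖ • fun i => polyMap (g σ i) x := by
      funext i
      simp only [g, Pi.smul_apply, polyMap_smul, Function.comp_apply, f, polyMap_sub,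
        Pi.sub_apply]
      rw [smul_smul, mul_inv_cancel₀ (norm_ne_zero_iff.2 (h0 σ)), one_smul]
    rw [h1, norm_smul, norm_norm]
    exact mul_le_mul (hσ₀ σ) (Finset.inf'_le _ (Finset.mem_univ σ)) (hN0 x) (norm_nonneg _)
  calc ENNReal.ofReal (c * ‖a i - b (σ₀ i)‖ ^ q)
      ≤ ENNReal.ofReal (‖f σ₀‖ ^ q) * ENNReal.ofReal c := by
        rw [← ENNReal.ofReal_mul (by positivity), mul_comm]
        refine ENNReal.ofReal_le_ofReal ?_
        gcongr
        exact norm_le_pi_norm (f σ₀) i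
    _ ≤ ENNReal.ofReal (‖f σ₀‖ ^ q) * ∫⁻ x in closedBall (0 : EuclideanSpace ℝ (Fin n)) (1 / 2),
          ENNReal.ofReal (N x ^ q) := by
        gcongr
        rw [← ofReal_integral_eq_lintegral_ofReal
          (hNq.continuousOn.integrableOn_compact (isCompact_closedBall _ _))
          (ae_of_all _ fun x => Real.rpow_nonneg (hN0 x) _)]
        exact ENNReal.ofReal_le_ofReal (hcg g hg)
    _ ≤ ENNReal.ofReal (‖f σ₀‖ ^ q) * ∫⁻ x in ball (0 : EuclideanSpace ℝ (Fin n)) 1,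
          ENNReal.ofReal (N x ^ q) := by
        gcongr
        exact closedBall_subset_ball (by norm_num)
    _ = ∫⁻ x in ball (0 : EuclideanSpace ℝ (Fin n)) 1,
          ENNReal.ofReal (‖f σ₀‖ ^ q) * ENNReal.ofReal (N x ^ q) :=
        (lintegral_const_mul' _ _ ENNReal.ofReal_ne_top).symm
    _ ≤ _ := by
        refine lintegral_mono fun x => ?_
        rw [← ENNReal.ofReal_mul (by positivity), ← Real.mul_rpow (norm_nonneg _) (hN0 x)]
        exact ENNReal.ofReal_le_ofReal
          (Real.rpow_le_rpow (mul_nonneg (norm_nonneg _) (hN0 x)) (hle x) hq.le)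

theorem lintegral_ball_affine (φ : EuclideanSpace ℝ (Fin n) → ℝ≥0∞)
    (x₀ : EuclideanSpace ℝ (Fin n)) {r : ℝ} (hr : 0 < r) :
    ∫⁻ x in ball x₀ r, φ x =
      ENNReal.ofReal (r ^ n) * ∫⁻ h in ball (0 : EuclideanSpace ℝ (Fin n)) 1, φ (x₀ + r • h) := by
  have himg : (fun h : EuclideanSpace ℝ (Fin n) => x₀ + r • h) '' ball 0 1 = ball x₀ r := by
    rw [← image_image (fun y => x₀ + y) (fun h => r • h), image_smul, smul_unitBall hr.ne',
      Real.norm_of_nonneg hr.le, image_add_left, preimage_add_ball, sub_neg_eq_add, zero_add]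
  have hinj : InjOn (fun h : EuclideanSpace ℝ (Fin n) => x₀ + r • h) (ball 0 1) := by
    intro a _ b _ hab
    exact smul_right_injective _ hr.ne' (add_left_cancel hab)
  have hder : ∀ h ∈ ball (0 : EuclideanSpace ℝ (Fin n)) 1,
      HasFDerivWithinAt (fun h : EuclideanSpace ℝ (Fin n) => x₀ + r • h)
        (r • ContinuousLinearMap.id ℝ (EuclideanSpace ℝ (Fin n))) (ball 0 1) h := fun h _ =>
    (((hasFDerivAt_id h).const_smul r).const_add x₀).hasFDerivWithinAt
  rw [← himg, lintegral_image_eq_lintegral_abs_det_fderiv_mul volume measurableSet_ball hder hinj]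
  have hdet : (r • ContinuousLinearMap.id ℝ (EuclideanSpace ℝ (Fin n))).det = r ^ n := by
    simp [ContinuousLinearMap.det]
  rw [hdet, abs_of_pos (pow_pos hr n), lintegral_const_mul' _ _ ENNReal.ofReal_ne_top]

/-- Each derivative brings out one factor `t`; with `t = 1 / r` this is the source of the `r ^ j` in
the comparison of polynomials. -/
theorem iteratedFDeriv_comp_rescale {E F : Type*} [NormedAddCommGroup E] [NormedSpace ℝ E]
    [NormedAddCommGroup F] [NormedSpace ℝ F] {g : E → F} {j : ℕ} (hg : ContDiff ℝ j g)
    (x₀ x : E) (t : ℝ) :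
    ‖iteratedFDeriv ℝ j (fun z => g (t • (z - x₀))) x‖ ≤
      ‖iteratedFDeriv ℝ j g (t • (x - x₀))‖ * |t| ^ j := by
  rw [iteratedFDeriv_comp_sub (f := fun y => g (t • y)) j x₀ x]
  have h1 : (fun y => g (t • y)) = g ∘ (t • ContinuousLinearMap.id ℝ E) := by
    funext y; simp
  rw [h1, ContinuousLinearMap.iteratedFDeriv_comp_right _ hg _ le_rfl]
  refine (ContinuousMultilinearMap.norm_compContinuousLinearMap_le _ _).trans ?_
  rw [Finset.prod_const, Finset.card_univ, Fintype.card_fin]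
  simp only [FunLike.coe_smul, Pi.smul_apply, ContinuousLinearMap.id_apply]
  gcongr
  refine (norm_smul_le _ _).trans ?_
  rw [Real.norm_eq_abs]
  exact mul_le_of_le_one_right (abs_nonneg _) ContinuousLinearMap.norm_id_le

/-- Two `Q`-valued polynomials that are close in `L^q` on a ball can be matched by one permutation
such that all their derivatives are close. -/
theorem exists_perm_polynomial_close (n m Q k : ℕ) {q : ℝ} (hq : 0 < q) :
    ∃ C : ℝ, 0 < C ∧
      ∀ f f' : Fin Q → EuclideanSpace ℝ (Fin n) → EuclideanSpace ℝ (Fin m),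
      (∀ i, IsPolyMap k (f i)) → (∀ i, IsPolyMap k (f' i)) →
      ∀ (x₀ : EuclideanSpace ℝ (Fin n)) (r H : ℝ), 0 < r → 0 ≤ H →
      ∫⁻ x in ball x₀ r, ENNReal.ofReal
        (AQ.G (AQ.mk fun i => f i x) (AQ.mk fun i => f' i x) ^ q) ≤
          ENNReal.ofReal (H ^ q * r ^ n) →
      ∃ σ : Equiv.Perm (Fin Q), ∀ i,
        (∀ x, ‖f i x - f' (σ i) x‖ ≤ C * H * max 1 (‖x - x₀‖ / r) ^ k) ∧
        ∀ j ≤ k + 1, ∀ x ∈ closedBall x₀ r,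
          ‖iteratedFDeriv ℝ j (f i) x - iteratedFDeriv ℝ j (f' (σ i)) x‖ ≤ C * H / r ^ j := by
  obtain ⟨c, hc, hperm⟩ := exists_perm_coeff_le n m Q k hq
  choose B hB0 hB using fun j => exists_norm_iteratedFDeriv_polyMap_le n m k j
  set N : ℝ := ((Fintype.card (polyExponents n k) : ℕ) : ℝ)
  set c' : ℝ := (c ^ (1 / q))⁻¹
  have hc' : 0 < c' := inv_pos.2 (Real.rpow_pos_of_pos hc _)
  -- A single constant dominating the growth bound and the derivative bounds of orders `0, …, k +
  -- 1`; the last 1 makes it positive.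
  set S : ℝ := N + ∑ j ∈ Finset.range (k + 2), B j + 1
  have hSB : 0 ≤ ∑ j ∈ Finset.range (k + 2), B j := Finset.sum_nonneg fun j _ => hB0 j
  have hN : 0 ≤ N := Nat.cast_nonneg _
  have hS : 0 < S := by positivity
  refine ⟨S * c', by positivity, fun f f' hf hf' x₀ r H hr hH hint => ?_⟩
  -- Coefficients are taken after rescaling `ball x₀ r` to the unit ball.
  choose a ha using fun i => ((hf i).comp_affine x₀ r).exists_coeff
  choose b hb using fun i => ((hf' i).comp_affine x₀ r).exists_coeff
  obtain ⟨σ, hσ⟩ := hperm a b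
  have hfa : ∀ i x, f i x = polyMap (a i) (r⁻¹ • (x - x₀)) := by
    intro i x
    rw [← ha]
    show f i x = f i (x₀ + r • r⁻¹ • (x - x₀))
    rw [smul_smul, mul_inv_cancel₀ hr.ne', one_smul, add_sub_cancel]
  have hfb : ∀ i x, f' i x = polyMap (b i) (r⁻¹ • (x - x₀)) := by
    intro i x
    rw [← hb]
    show f' i x = f' i (x₀ + r • r⁻¹ • (x - x₀))
    rw [smul_smul, mul_inv_cancel₀ hr.ne', one_smul, add_sub_cancel]
  have hd : ∀ i, ‖a i - b (σ i)‖ ≤ c' * H := by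
    intro i
    have h1 := hσ i
    have h2 : ∫⁻ x in ball (0 : EuclideanSpace ℝ (Fin n)) 1, ENNReal.ofReal
          (AQ.permDist (fun i => polyMap (a i) x) (fun i => polyMap (b i) x) ^ q) ≤
        ENNReal.ofReal (H ^ q) := by
      rw [lintegral_ball_affine _ _ hr, mul_comm (H ^ q),
        ENNReal.ofReal_mul (by positivity)] at hint
      have h3 := (ENNReal.mul_le_mul_iff_right (by simpa using pow_pos hr n)
        ENNReal.ofReal_ne_top).1 hint
      refine le_trans (le_of_eq ?_) h3
      refine lintegral_congr fun h => ?_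
      rw [AQ.G_mk]
      simp only [← ha, ← hb]
    have h4 := h1.trans h2
    rw [ENNReal.ofReal_le_ofReal_iff (by positivity)] at h4
    have h5 : c ^ (1 / q) * ‖a i - b (σ i)‖ ≤ H := by
      rw [← Real.rpow_le_rpow_iff (by positivity) hH hq, Real.mul_rpow (by positivity)
        (norm_nonneg _), ← Real.rpow_mul hc.le, one_div_mul_cancel hq.ne', Real.rpow_one]
      exact h4
    rw [inv_mul_eq_div, le_div_iff₀ (by positivity), mul_comm]
    exact h5
  refine ⟨σ, fun i => ⟨fun x => ?_, fun j hj x hx => ?_⟩⟩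
  · rw [hfa, hfb, ← Pi.sub_apply, ← polyMap_sub]
    refine (norm_polyMap_le _ _).trans ?_
    have h1 : ‖r⁻¹ • (x - x₀)‖ = ‖x - x₀‖ / r := by
      rw [norm_smul, norm_inv, Real.norm_of_nonneg hr.le, inv_mul_eq_div]
    rw [h1, mul_assoc S]
    have : N ≤ S := by simp only [S]; linarith
    gcongr
    exact hd i
  · have hsub : iteratedFDeriv ℝ j (f i) x - iteratedFDeriv ℝ j (f' (σ i)) x =
        iteratedFDeriv ℝ j (fun z => polyMap (a i - b (σ i)) (r⁻¹ • (z - x₀))) x := by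
      rw [← iteratedFDeriv_sub_apply (hf i).contDiff.contDiffAt (hf' (σ i)).contDiff.contDiffAt]
      congr 1
      funext z
      rw [Pi.sub_apply, hfa, hfb, polyMap_sub, Pi.sub_apply]
    rw [hsub]
    refine (iteratedFDeriv_comp_rescale (contDiff_polyMap _) _ _ _).trans ?_
    have hmem : r⁻¹ • (x - x₀) ∈ closedBall (0 : EuclideanSpace ℝ (Fin n)) 1 := by
      rw [mem_closedBall_zero_iff, norm_smul, norm_inv, Real.norm_of_nonneg hr.le,
        inv_mul_le_iff₀ hr, mul_one, ← dist_eq_norm]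
      exact hx
    have hBS : B j ≤ S := by
      have := Finset.single_le_sum (f := B) (fun j _ => hB0 j)
        (Finset.mem_range.2 (show j < k + 2 by omega))
      simp only [S]; linarith
    rw [abs_of_pos (inv_pos.2 hr), inv_pow, ← div_eq_mul_inv, mul_assoc S]
    gcongr
    refine (hB j _ _ hmem).trans ?_
    gcongr
    exact hd i

/-! ### The metric of `𝒜_Q` and `L^q` distances -/

theorem AQ.tupleDist_le_sum {F : Type*} [NormedAddCommGroup F] (a b : Fin Q → F) :
    AQ.tupleDist a b ≤ ∑ i, ‖a i - b i‖ := by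
  refine Real.sqrt_le_iff.2 ⟨Finset.sum_nonneg fun _ _ => norm_nonneg _, ?_⟩
  exact Finset.sum_sq_le_sq_sum_of_nonneg fun _ _ => norm_nonneg _

theorem AQ.G_mk_le_sum {F : Type*} [NormedAddCommGroup F] (a b : Fin Q → F)
    (σ : Equiv.Perm (Fin Q)) : AQ.G (AQ.mk a) (AQ.mk b) ≤ ∑ i, ‖a i - b (σ i)‖ :=
  (AQ.permDist_le a b σ).trans (AQ.tupleDist_le_sum _ _)

theorem AQ.G_mk_le_mul {F : Type*} [NormedAddCommGroup F] {a b : Fin Q → F}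
    (σ : Equiv.Perm (Fin Q)) {t : ℝ} (h : ∀ i, ‖a i - b (σ i)‖ ≤ t) :
    AQ.G (AQ.mk a) (AQ.mk b) ≤ Q * t := by
  refine (AQ.G_mk_le_sum a b σ).trans ((Finset.sum_le_card_nsmul _ _ t fun i _ => h i).trans ?_)
  simp

theorem AQ.continuous_mk {F : Type*} [NormedAddCommGroup F] :
    Continuous (AQ.mk : (Fin Q → F) → AQ Q F) := by
  refine continuous_iff_continuousAt.2 fun a => ?_
  rw [ContinuousAt, tendsto_iff_dist_tendsto_zero]
  refine squeeze_zero (fun _ => dist_nonneg) (fun b => AQ.G_mk_le_sum b a 1) ?_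
  have : Continuous fun b : Fin Q → F => ∑ i, ‖b i - a i‖ := by fun_prop
  simpa using this.tendsto a

theorem AQ.G_comm {F : Type*} [NormedAddCommGroup F] (S T : AQ Q F) : AQ.G S T = AQ.G T S :=
  dist_comm S T

theorem AQ.G_nonneg {F : Type*} [NormedAddCommGroup F] (S T : AQ Q F) : 0 ≤ AQ.G S T :=
  dist_nonneg (x := S) (y := T)

theorem AQ.G_triangle {F : Type*} [NormedAddCommGroup F] (S T U : AQ Q F) :
    AQ.G S U ≤ AQ.G S T + AQ.G T U :=
  dist_triangle S T U

/-- The `Q`-valued function with the given sheets. -/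
def AQ.sheets {E F : Type*} (f : Fin Q → E → F) (x : E) : AQ Q F := AQ.mk fun i => f i x

/-- The integral of `𝒢(u, v)^q` over `s`. -/
def lqDist {F : Type*} [NormedAddCommGroup F] (q : ℝ)
    (u v : EuclideanSpace ℝ (Fin n) → AQ Q F) (s : Set (EuclideanSpace ℝ (Fin n))) : ℝ≥0∞ :=
  ∫⁻ x in s, ENNReal.ofReal (AQ.G (u x) (v x) ^ q)

theorem continuous_sheets {f : Fin Q → EuclideanSpace ℝ (Fin n) → EuclideanSpace ℝ (Fin m)}
    (hf : ∀ i, IsPolyMap k (f i)) : Continuous (AQ.sheets f) :=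
  AQ.continuous_mk.comp (continuous_pi fun i => ((hf i).contDiff (N := 0)).continuous)

theorem add_rpow_le_two_rpow_mul {a b q : ℝ} (ha : 0 ≤ a) (hb : 0 ≤ b) (hq : 0 ≤ q) :
    (a + b) ^ q ≤ 2 ^ q * (a ^ q + b ^ q) := by
  wlog hab : a ≤ b generalizing a b
  · rw [add_comm a, add_comm (a ^ q)]
    exact this hb ha (le_of_not_ge hab)
  calc (a + b) ^ q ≤ (2 * b) ^ q := Real.rpow_le_rpow (by positivity) (by linarith) hq
    _ = 2 ^ q * b ^ q := Real.mul_rpow (by norm_num) hb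
    _ ≤ _ := by
      gcongr
      exact le_add_of_nonneg_left (Real.rpow_nonneg ha _)

section lqDist

variable {F : Type*} [NormedAddCommGroup F] {q : ℝ}
  {u v w : EuclideanSpace ℝ (Fin n) → AQ Q F} {s t : Set (EuclideanSpace ℝ (Fin n))}

theorem lqDist_mono_set (h : s ⊆ t) : lqDist q u v s ≤ lqDist q u v t :=
  lintegral_mono_set h

theorem lqDist_comm : lqDist q u v s = lqDist q v u s := by
  simp only [lqDist, AQ.G_comm]

theorem aemeasurable_rpow_G (hu : AEStronglyMeasurable u (volume.restrict s))
    (hv : AEStronglyMeasurable v (volume.restrict s)) :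
    AEMeasurable (fun x => ENNReal.ofReal (AQ.G (u x) (v x) ^ q)) (volume.restrict s) :=
  ((hu.dist hv).aemeasurable.pow_const q).ennreal_ofReal

theorem lqDist_triangle (hq : 0 ≤ q) (hu : AEStronglyMeasurable u (volume.restrict s))
    (hv : AEStronglyMeasurable v (volume.restrict s)) {a b c : ℝ} (ha : 0 ≤ a) (hb : 0 ≤ b)
    (huv : lqDist q u v s ≤ ENNReal.ofReal a) (hvw : lqDist q v w s ≤ ENNReal.ofReal b)
    (hc : 2 ^ q * (a + b) ≤ c) : lqDist q u w s ≤ ENNReal.ofReal c := by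
  calc lqDist q u w s ≤ ∫⁻ x in s, ENNReal.ofReal (2 ^ q) *
        (ENNReal.ofReal (AQ.G (u x) (v x) ^ q) + ENNReal.ofReal (AQ.G (v x) (w x) ^ q)) := by
        refine lintegral_mono fun x => ?_
        rw [← ENNReal.ofReal_add (Real.rpow_nonneg (AQ.G_nonneg _ _) _)
          (Real.rpow_nonneg (AQ.G_nonneg _ _) _), ← ENNReal.ofReal_mul (by positivity)]
        refine ENNReal.ofReal_le_ofReal (le_trans ?_ (add_rpow_le_two_rpow_mul
          (AQ.G_nonneg _ _) (AQ.G_nonneg _ _) hq))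
        exact Real.rpow_le_rpow (AQ.G_nonneg _ _) (AQ.G_triangle _ _ _) hq
    _ = ENNReal.ofReal (2 ^ q) * (lqDist q u v s + lqDist q v w s) := by
        rw [lintegral_const_mul' _ _ ENNReal.ofReal_ne_top,
          lintegral_add_left' (aemeasurable_rpow_G hu hv)]
        rfl
    _ ≤ ENNReal.ofReal (2 ^ q) * (ENNReal.ofReal a + ENNReal.ofReal b) := by gcongr
    _ = ENNReal.ofReal (2 ^ q * (a + b)) := by
        rw [← ENNReal.ofReal_add ha hb, ← ENNReal.ofReal_mul (by positivity)]
    _ ≤ _ := ENNReal.ofReal_le_ofReal hc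

theorem volume_ball_eq (x : EuclideanSpace ℝ (Fin n)) {r : ℝ} (hr : 0 < r) :
    volume (ball x r) = ENNReal.ofReal
      (r ^ n * (volume (ball (0 : EuclideanSpace ℝ (Fin n)) 1)).toReal) := by
  rw [Measure.addHaar_ball_of_pos _ _ hr, ENNReal.ofReal_mul (by positivity),
    ENNReal.ofReal_toReal measure_ball_lt_top.ne, finrank_euclideanSpace, Fintype.card_fin]

theorem lqDist_ball_le_of_forall_le (hq : 0 ≤ q) {x : EuclideanSpace ℝ (Fin n)} {r B : ℝ}
    (hr : 0 < r) (hB : 0 ≤ B) (h : ∀ z ∈ ball x r, AQ.G (u z) (v z) ≤ B) :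
    lqDist q u v (ball x r) ≤ ENNReal.ofReal
      (B ^ q * (r ^ n * (volume (ball (0 : EuclideanSpace ℝ (Fin n)) 1)).toReal)) := by
  rw [ENNReal.ofReal_mul (by positivity), ← volume_ball_eq x hr, ← setLIntegral_const]
  refine setLIntegral_mono measurable_const fun z hz => ENNReal.ofReal_le_ofReal ?_
  exact Real.rpow_le_rpow (AQ.G_nonneg _ _) (h z hz) hq

end lqDist

theorem ENNReal.le_ofReal_of_le_ofReal_mul {x y : ℝ≥0∞} {a b c : ℝ} (ha : 0 ≤ a)
    (h : x ≤ ENNReal.ofReal a * y) (hy : y ≤ ENNReal.ofReal b) (hc : a * b ≤ c) :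
    x ≤ ENNReal.ofReal c := by
  refine h.trans ((mul_le_mul_right hy _).trans ?_)
  rw [← ENNReal.ofReal_mul ha]
  exact ENNReal.ofReal_le_ofReal hc

/-! ### Decay at every point -/

/-- The exponent `n + kq + qμ` of the decay of `∫_{B_σ} 𝒢(u, p)^q`. -/
def decayExp (n k : ℕ) (q μ : ℝ) : ℝ := n + k * q + q * μ

/-- `u` has decaying `L^q` distance to the `Q`-valued polynomials `p x₀`: from the scale `ε` down
at points of `Γ`, and from the scale `dist(x₀, Γ)` down at the other points. -/
structure HasQPolyDecay (k : ℕ) (q β₁ β₂ ε μ : ℝ) (U Γ : Set (EuclideanSpace ℝ (Fin n)))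
    (u : EuclideanSpace ℝ (Fin n) → AQ Q (EuclideanSpace ℝ (Fin m)))
    (p : EuclideanSpace ℝ (Fin n) → Fin Q → EuclideanSpace ℝ (Fin n) → EuclideanSpace ℝ (Fin m))
    (β I : ℝ) : Prop where
  isClosed : IsClosed Γ
  nonempty : (Γ ∩ closure U).Nonempty
  aestronglyMeasurable : AEStronglyMeasurable u (volume.restrict U)
  nonneg : 0 ≤ I
  lintegral_le : ∫⁻ x in U, ENNReal.ofReal ((u x).mag ^ q) ≤ ENNReal.ofReal I
  isPolyMap : ∀ x₀ i, IsPolyMap k (p x₀ i)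
  mag_le : ∀ x₀ ∈ Γ ∩ closure U, ∀ x ∈ U, (AQ.sheets (p x₀) x).mag ≤ β
  decay_mem : ∀ x₀ ∈ Γ ∩ closure U, ∀ σ ρ : ℝ, 0 < σ → σ ≤ ρ / 2 → ρ ≤ ε → ball x₀ ρ ⊆ U →
    lqDist q u (AQ.sheets (p x₀)) (ball x₀ σ) ≤
      ENNReal.ofReal (β₁ * (σ / ρ) ^ decayExp n k q μ) *
        lqDist q u (AQ.sheets (p x₀)) (ball x₀ ρ)
  decay_notMem : ∀ x₀ ∈ U \ Γ, ∀ y ∈ Γ ∩ closure U, ∀ σ ρ : ℝ, 0 < σ → σ ≤ ρ / 2 →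
    ρ < 1 / 4 → ρ < infDist x₀ Γ → ball x₀ ρ ⊆ U →
    lqDist q u (AQ.sheets (p x₀)) (ball x₀ σ) ≤
      ENNReal.ofReal (β₂ * (σ / ρ) ^ decayExp n k q μ) *
        lqDist q u (AQ.sheets (p y)) (ball x₀ ρ)

theorem decayExp_nonneg {q μ : ℝ} (hq : 0 ≤ q) (hμ : 0 ≤ μ) : 0 ≤ decayExp n k q μ := by
  unfold decayExp; positivity

theorem decayExp_le {q μ : ℝ} (hq : 0 ≤ q) (hμ : μ ≤ 1) :
    decayExp n k q μ ≤ decayExp n k q 1 := by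
  unfold decayExp; gcongr

/-- Used with `e₁` the exponent for `μ = 1`, so that the factor from the fixed scale `ρ` does not
depend on `μ`. -/
theorem div_rpow_le_of_le_one {σ ρ e e₁ : ℝ} (hσ : 0 ≤ σ) (hρ : 0 < ρ) (hρ1 : ρ ≤ 1)
    (he : e ≤ e₁) : (σ / ρ) ^ e ≤ ρ ^ (-e₁) * σ ^ e := by
  rw [Real.div_rpow hσ hρ.le, div_eq_mul_inv, ← Real.rpow_neg hρ.le, mul_comm]
  gcongr ?_ * _
  exact Real.rpow_le_rpow_of_exponent_ge hρ hρ1 (neg_le_neg he)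

theorem mul_rpow_le_of_one_le {t σ e e₁ : ℝ} (ht : 1 ≤ t) (hσ : 0 ≤ σ) (he : e ≤ e₁) :
    (t * σ) ^ e ≤ t ^ e₁ * σ ^ e := by
  rw [Real.mul_rpow (by linarith) hσ]
  gcongr

/-- Translates integral decay into the normalisation `H ^ q * r ^ n` of the polynomial comparison,
with `H` of order `r ^ (k + μ)`. -/
theorem rpow_mul_decay {q μ M r : ℝ} (hq : 0 < q) (hM : 0 ≤ M) (hr : 0 < r) :
    (M ^ (1 / q) * r ^ (k + μ)) ^ q * r ^ n = M * r ^ decayExp n k q μ := by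
  rw [Real.mul_rpow (by positivity) (by positivity), ← Real.rpow_mul hM, ← Real.rpow_mul hr.le,
    one_div_mul_cancel hq.ne', Real.rpow_one, mul_assoc, ← Real.rpow_natCast r n,
    ← Real.rpow_add hr]
  congr 2
  unfold decayExp; ring

namespace HasQPolyDecay

variable {q β₁ β₂ ε μ : ℝ} {U Γ : Set (EuclideanSpace ℝ (Fin n))}
  {u : EuclideanSpace ℝ (Fin n) → AQ Q (EuclideanSpace ℝ (Fin m))}
  {p : EuclideanSpace ℝ (Fin n) → Fin Q → EuclideanSpace ℝ (Fin n) → EuclideanSpace ℝ (Fin m)}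
  {β I : ℝ}

theorem measurable_sheets (h : HasQPolyDecay k q β₁ β₂ ε μ U Γ u p β I)
    (x₀ : EuclideanSpace ℝ (Fin n)) (s : Set (EuclideanSpace ℝ (Fin n))) :
    AEStronglyMeasurable (AQ.sheets (p x₀)) (volume.restrict s) :=
  (continuous_sheets (h.isPolyMap x₀)).aestronglyMeasurable

theorem measurable_ball (h : HasQPolyDecay k q β₁ β₂ ε μ U Γ u p β I)
    {s : Set (EuclideanSpace ℝ (Fin n))} (hs : s ⊆ U) :
    AEStronglyMeasurable u (volume.restrict s) :=
  h.aestronglyMeasurable.mono_measure (Measure.restrict_mono hs le_rfl)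

/-- Triangle inequality through the zero tuple: this bounds the right-hand sides of (I) and (II) at
a fixed scale. -/
theorem lqDist_base_le (h : HasQPolyDecay k q β₁ β₂ ε μ U Γ u p β I) (hq : 0 < q)
    (hβ : 0 < β) {x y : EuclideanSpace ℝ (Fin n)} (hy : y ∈ Γ ∩ closure U) {ρ : ℝ} (hρ : 0 < ρ)
    (hρ1 : ρ ≤ 1) (hx : ball x ρ ⊆ U) :
    lqDist q u (AQ.sheets (p y)) (ball x ρ) ≤ ENNReal.ofReal
      (2 ^ q * (1 + (volume (ball (0 : EuclideanSpace ℝ (Fin n)) 1)).toReal) * (β ^ q + I)) := by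
  set V := (volume (ball (0 : EuclideanSpace ℝ (Fin n)) 1)).toReal
  have hV : 0 ≤ V := ENNReal.toReal_nonneg
  have h1 : lqDist q u (fun _ => AQ.mk fun _ => 0) (ball x ρ) ≤ ENNReal.ofReal I :=
    (lintegral_mono_set hx).trans h.lintegral_le
  have h2 : lqDist q (fun _ => AQ.mk fun _ => 0) (AQ.sheets (p y)) (ball x ρ) ≤
      ENNReal.ofReal (β ^ q * V) := by
    refine (lqDist_ball_le_of_forall_le hq.le hρ hβ.le fun z hz => ?_).trans
      (ENNReal.ofReal_le_ofReal ?_)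
    · rw [AQ.G_comm]
      exact h.mag_le y hy z (hx hz)
    · gcongr
      exact mul_le_of_le_one_left hV (pow_le_one₀ hρ.le hρ1)
  refine lqDist_triangle hq.le (h.measurable_ball hx) aestronglyMeasurable_const h.nonneg
    (by positivity) h1 h2 ?_
  rw [mul_assoc]
  gcongr
  have := h.nonneg
  have : 0 ≤ β ^ q := by positivity
  nlinarith [mul_nonneg hV h.nonneg]

theorem lqDist_le_of_mem (h : HasQPolyDecay k q β₁ β₂ ε μ U Γ u p β I) (hq : 0 < q)
    (hβ : 0 < β) (hβ₁ : 0 < β₁) (hμ1 : μ ≤ 1) {y : EuclideanSpace ℝ (Fin n)} (hy : y ∈ Γ ∩ closure U)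
    {ρ σ : ℝ} (hρ1 : ρ ≤ 1) (hρε : ρ ≤ ε) (hyU : ball y ρ ⊆ U) (hσ : 0 < σ) (hσρ : σ ≤ ρ / 2) :
    lqDist q u (AQ.sheets (p y)) (ball y σ) ≤ ENNReal.ofReal
      (β₁ * ρ ^ (-decayExp n k q 1) *
        (2 ^ q * (1 + (volume (ball (0 : EuclideanSpace ℝ (Fin n)) 1)).toReal)) * (β ^ q + I) *
          σ ^ decayExp n k q μ) := by
  have hρ : 0 < ρ := by linarith
  have hI := h.nonneg
  have hV : 0 ≤ (volume (ball (0 : EuclideanSpace ℝ (Fin n)) 1)).toReal := ENNReal.toReal_nonneg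
  refine ENNReal.le_ofReal_of_le_ofReal_mul (by positivity) (h.decay_mem y hy σ ρ hσ hσρ hρε hyU)
    (h.lqDist_base_le hq hβ hy hρ hρ1 hyU) ?_
  calc β₁ * (σ / ρ) ^ decayExp n k q μ *
        (2 ^ q * (1 + (volume (ball (0 : EuclideanSpace ℝ (Fin n)) 1)).toReal) * (β ^ q + I))
      ≤ β₁ * (ρ ^ (-decayExp n k q 1) * σ ^ decayExp n k q μ) *
        (2 ^ q * (1 + (volume (ball (0 : EuclideanSpace ℝ (Fin n)) 1)).toReal) * (β ^ q + I)) := by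
        gcongr
        exact div_rpow_le_of_le_one hσ.le hρ hρ1 (decayExp_le hq.le hμ1)
    _ = _ := by ring

end HasQPolyDecay

/-- The decay estimate holds at all points of `U` of distance at least `δ` from the complement,
uniformly below a fixed scale. -/
theorem exists_uniform_decay (n m Q k : ℕ) {q β₁ β₂ ε δ : ℝ} (hq : 0 < q) (hβ₁ : 0 < β₁)
    (hβ₂ : 0 < β₂) (hε : 0 < ε) (hε4 : ε < 1 / 4) (hδ : 0 < δ) :
    ∃ K r₀ : ℝ, 0 < K ∧ 0 < r₀ ∧ r₀ < 1 / 4 ∧ r₀ < δ ∧ ∀ μ ∈ Ioo (0 : ℝ) 1,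
      ∀ (U Γ : Set (EuclideanSpace ℝ (Fin n)))
        (u : EuclideanSpace ℝ (Fin n) → AQ Q (EuclideanSpace ℝ (Fin m)))
        (p : EuclideanSpace ℝ (Fin n) → Fin Q → EuclideanSpace ℝ (Fin n) →
          EuclideanSpace ℝ (Fin m)) (β I : ℝ), 0 < β →
        HasQPolyDecay k q β₁ β₂ ε μ U Γ u p β I →
        ∀ x, ball x δ ⊆ U → ∀ σ, 0 < σ → σ ≤ r₀ →
          lqDist q u (AQ.sheets (p x)) (ball x σ) ≤
            ENNReal.ofReal (K * (β ^ q + I) * σ ^ decayExp n k q μ) := by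
  obtain ⟨C, hC, hpoly⟩ := exists_perm_polynomial_close n m Q k hq
  set V := (volume (ball (0 : EuclideanSpace ℝ (Fin n)) 1)).toReal with hVdef
  have hV : 0 ≤ V := ENNReal.toReal_nonneg
  -- At scale `ρ₀` hypothesis (I) applies, and balls of this radius about points close to `x` stay
  -- inside `ball x δ`.
  set ρ₀ := min ε (δ / 2)
  have hρ₀ : 0 < ρ₀ := by positivity
  have hρ₀ε : ρ₀ ≤ ε := min_le_left _ _
  have hρ₀δ : ρ₀ ≤ δ / 2 := min_le_right _ _
  set e₁ := decayExp n k q 1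
  -- `K₁` serves points of `Γ`, `K₂` points far from `Γ`, `K₃` small scales near `Γ`, `K₄` the
  -- comparison of `p x` with `p y`, and `K₅` large scales near `Γ`.
  set K₀ := 2 ^ q * (1 + V) with hK₀
  set K₁ := β₁ * ρ₀ ^ (-e₁) * K₀ with hK₁
  set K₂ := β₂ * (ρ₀ / 16) ^ (-e₁) * K₀ with hK₂
  set K₃ := β₂ * K₁ * 6 ^ e₁ with hK₃
  set K₄ := 2 ^ q * (K₃ + K₁ * 12 ^ e₁) with hK₄
  set K₅ := 2 ^ q * (K₁ * 9 ^ e₁ + (Q * C) ^ q * K₄ * V) with hK₅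
  have hK₀0 : 0 < K₀ := by positivity
  have hK₁0 : 0 < K₁ := by positivity
  have hK₂0 : 0 < K₂ := by positivity
  have hK₃0 : 0 < K₃ := by positivity
  have hK₄0 : 0 < K₄ := by positivity
  have hK₅0 : 0 < K₅ := by positivity
  refine ⟨K₁ + K₂ + K₃ + K₅, ρ₀ / 32, by positivity, by positivity, by linarith, by linarith, ?_⟩
  rintro μ ⟨hμ0, hμ1⟩ U Γ u p β I hβ h x hx σ hσ hσr
  have hI := h.nonneg
  set M := β ^ q + I
  have hM : 0 ≤ M := by positivity
  set e := decayExp n k q μ with he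
  have hee : e ≤ e₁ := decayExp_le hq.le hμ1.le
  have he0 : 0 ≤ e := decayExp_nonneg hq.le hμ0.le
  have hxU : x ∈ U := hx (mem_ball_self hδ)
  have hσe : 0 ≤ M * σ ^ e := by positivity
  have final : ∀ K', K' ≤ K₁ + K₂ + K₃ + K₅ →
      lqDist q u (AQ.sheets (p x)) (ball x σ) ≤ ENNReal.ofReal (K' * M * σ ^ e) →
      lqDist q u (AQ.sheets (p x)) (ball x σ) ≤
        ENNReal.ofReal ((K₁ + K₂ + K₃ + K₅) * M * σ ^ e) := fun K' hK' h' => by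
    refine h'.trans (ENNReal.ofReal_le_ofReal ?_)
    gcongr
  have hbad : ∀ y ∈ Γ ∩ closure U, ball y ρ₀ ⊆ U → ∀ s, 0 < s → s ≤ ρ₀ / 2 →
      lqDist q u (AQ.sheets (p y)) (ball y s) ≤ ENNReal.ofReal (K₁ * M * s ^ e) :=
    fun y hy hyU s hs hsρ => h.lqDist_le_of_mem hq hβ hβ₁ hμ1.le hy (by linarith) hρ₀ε hyU hs hsρ
  by_cases hxΓ : x ∈ Γ
  · exact final K₁ (by linarith) (hbad x ⟨hxΓ, subset_closure hxU⟩
      ((ball_subset_ball (by linarith)).trans hx) σ hσ (by linarith))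
  have hΓne : Γ.Nonempty := h.nonempty.mono inter_subset_left
  set d := infDist x Γ
  have hd : 0 < d := (h.isClosed.notMem_iff_infDist_pos hΓne).1 hxΓ
  -- Far from `Γ`, (II) is applied once at the fixed scale `ρ₀ / 16`, with an arbitrary `y`.
  rcases le_or_gt (ρ₀ / 8) d with hdρ | hdρ
  · obtain ⟨y, hy⟩ := h.nonempty
    have hsub : ball x (ρ₀ / 16) ⊆ U := (ball_subset_ball (by linarith)).trans hx
    refine final K₂ (by linarith) (ENNReal.le_ofReal_of_le_ofReal_mul (by positivity)
      (h.decay_notMem x ⟨hxU, hxΓ⟩ y hy σ (ρ₀ / 16) hσ (by linarith) (by linarith) (by linarith)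
        hsub) (h.lqDist_base_le hq hβ hy (by positivity) (by linarith) hsub) ?_)
    have := div_rpow_le_of_le_one hσ.le (show 0 < ρ₀ / 16 by positivity) (by linarith) hee
    calc β₂ * (σ / (ρ₀ / 16)) ^ e * (K₀ * M)
        ≤ β₂ * ((ρ₀ / 16) ^ (-e₁) * σ ^ e) * (K₀ * M) := by gcongr
      _ = K₂ * M * σ ^ e := by rw [hK₂]; ring
  -- An almost nearest point of `Γ` suffices; the factor 2 gives the strict inequality that provides
  -- it.
  obtain ⟨y, hyΓ, hxy⟩ := (infDist_lt_iff hΓne).1 (show infDist x Γ < 2 * d by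
    show d < 2 * d
    linarith)
  have hyball : ball y ρ₀ ⊆ ball x δ := ball_subset_ball' (by rw [dist_comm]; linarith)
  have hyU : ball y ρ₀ ⊆ U := hyball.trans hx
  have hy : y ∈ Γ ∩ closure U :=
    ⟨hyΓ, subset_closure (hyU (mem_ball_self hρ₀))⟩
  -- (II) descends from scale `d / 2` to `s`, and the decay at `y` on `ball y (3 * d)` controls the
  -- starting scale. The powers of `d` cancel.
  have hsmall : ∀ s, 0 < s → s ≤ d / 4 →
      lqDist q u (AQ.sheets (p x)) (ball x s) ≤ ENNReal.ofReal (K₃ * M * s ^ e) := by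
    intro s hs hsd
    have hsub : ball x (d / 2) ⊆ ball y (3 * d) := ball_subset_ball' (by linarith)
    refine ENNReal.le_ofReal_of_le_ofReal_mul (by positivity)
      (h.decay_notMem x ⟨hxU, hxΓ⟩ y hy s (d / 2) hs (by linarith) (by linarith) (by
        show d / 2 < d
        linarith) ((ball_subset_ball (by linarith)).trans hx))
      ((lqDist_mono_set hsub).trans (hbad y hy hyU (3 * d) (by linarith) (by linarith))) ?_
    have h6 : (s / (d / 2)) ^ e * (3 * d) ^ e = (6 * s) ^ e := by
      rw [← Real.mul_rpow (by positivity) (by positivity)]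
      congr 1
      field_simp
      norm_num
    calc β₂ * (s / (d / 2)) ^ e * (K₁ * M * (3 * d) ^ e)
        = β₂ * K₁ * M * ((s / (d / 2)) ^ e * (3 * d) ^ e) := by ring
      _ ≤ β₂ * K₁ * M * (6 ^ e₁ * s ^ e) := by
        rw [h6]
        gcongr
        exact mul_rpow_le_of_one_le (by norm_num) hs.le hee
      _ = K₃ * M * s ^ e := by rw [hK₃]; ring
  rcases le_or_gt σ (d / 4) with hσd | hσd
  · exact final K₃ (by linarith) (hsmall σ hσ hσd)
  set r := d / 4 with hr
  have hr0 : 0 < r := by positivity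
  have hxr : ball x r ⊆ U := (ball_subset_ball (by linarith)).trans hx
  -- On `ball x r` both polynomials are close to `u`: one by the small-scale case, the other because
  -- the ball lies in `ball y (12 * r)`.
  have hclose : lqDist q (AQ.sheets (p x)) (AQ.sheets (p y)) (ball x r) ≤
      ENNReal.ofReal (K₄ * M * r ^ e) := by
    refine lqDist_triangle hq.le (h.measurable_sheets x _) (h.measurable_ball hxr)
      (by positivity : 0 ≤ K₃ * M * r ^ e) (by positivity : 0 ≤ K₁ * M * (12 * r) ^ e)
      (lqDist_comm.trans_le (hsmall r hr0 le_rfl)) ?_ ?_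
    · refine (lqDist_mono_set (ball_subset_ball' (by linarith))).trans
        (hbad y hy hyU (12 * r) (by positivity) (by linarith))
    · have := mul_rpow_le_of_one_le (show (1 : ℝ) ≤ 12 by norm_num) hr0.le hee
      calc 2 ^ q * (K₃ * M * r ^ e + K₁ * M * (12 * r) ^ e)
          ≤ 2 ^ q * (K₃ * M * r ^ e + K₁ * M * (12 ^ e₁ * r ^ e)) := by gcongr
        _ = K₄ * M * r ^ e := by rw [hK₄]; ring
  set H := (K₄ * M) ^ (1 / q)
  have hH : 0 ≤ H := by positivity
  obtain ⟨τ, hτ⟩ := hpoly (p x) (p y) (h.isPolyMap x) (h.isPolyMap y) x r (H * r ^ (k + μ)) hr0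
    (by positivity) (hclose.trans_eq (by rw [rpow_mul_decay hq (by positivity) hr0]))
  -- From radius `r` to `σ > r` the difference grows at most by `(σ / r) ^ k`, and `r ^ (k + μ) * (σ
  -- / r) ^ k = r ^ μ * σ ^ k ≤ σ ^ (k + μ)`.
  have hG : ∀ z ∈ ball x σ, AQ.G (AQ.sheets (p y) z) (AQ.sheets (p x) z) ≤
      Q * C * (H * σ ^ (k + μ)) := by
    intro z hz
    rw [AQ.G_comm, mul_assoc]
    refine AQ.G_mk_le_mul τ fun i => ((hτ i).1 z).trans ?_
    have hmax : max 1 (‖z - x‖ / r) ≤ σ / r := by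
      refine max_le ((one_le_div hr0).2 hσd.le) ?_
      gcongr
      rw [← dist_eq_norm]
      exact (mem_ball.1 hz).le
    calc C * (H * r ^ (k + μ)) * max 1 (‖z - x‖ / r) ^ k
        ≤ C * (H * r ^ (k + μ)) * (σ / r) ^ k := by gcongr
      _ = C * H * (r ^ μ * σ ^ k) := by
        rw [Real.rpow_add hr0, Real.rpow_natCast, div_pow σ r]
        have : r ^ k ≠ 0 := by positivity
        clear_value r
        field_simp
      _ ≤ C * H * (σ ^ μ * σ ^ k) := by gcongr
      _ = C * (H * σ ^ (k + μ)) := by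
        rw [Real.rpow_add hσ, Real.rpow_natCast]; ring
  have hyx := lqDist_ball_le_of_forall_le hq.le hσ (by positivity) hG
  rw [← hVdef] at hyx
  have hxσ : ball x σ ⊆ U := (ball_subset_ball (by linarith)).trans hx
  -- Since `dist x y < 2 * d < 8 * σ`, the ball `ball x σ` lies in `ball y (9 * σ)`.
  refine final K₅ (by linarith) (lqDist_triangle hq.le (h.measurable_ball hxσ)
    (h.measurable_sheets y _) (by positivity : 0 ≤ K₁ * M * (9 * σ) ^ e) (by positivity)
    ((lqDist_mono_set (ball_subset_ball' (by linarith))).trans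
      (hbad y hy hyU (9 * σ) (by positivity) (by linarith))) hyx ?_)
  have h9 := mul_rpow_le_of_one_le (show (1 : ℝ) ≤ 9 by norm_num) hσ.le hee
  have hHq : (Q * C * (H * σ ^ (k + μ))) ^ q * (σ ^ n * V) =
      (Q * C) ^ q * (K₄ * M * σ ^ e) * V := by
    rw [he, ← rpow_mul_decay hq (by positivity) hσ, Real.mul_rpow (by positivity) (by positivity)]
    ring
  rw [hHq]
  calc 2 ^ q * (K₁ * M * (9 * σ) ^ e + (Q * C) ^ q * (K₄ * M * σ ^ e) * V)
      ≤ 2 ^ q * (K₁ * M * (9 ^ e₁ * σ ^ e) + (Q * C) ^ q * (K₄ * M * σ ^ e) * V) := by gcongr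
    _ = K₅ * M * σ ^ e := by rw [hK₅]; ring

/-! ### Bounds for the jets of the approximating polynomials -/

/-- The jets of the polynomials `p x` are bounded by `B` near `x` for `x ∈ S`, and those of `p x`
and `p y` agree at `y` up to the order of a `C^{k,μ}` function with constant `B`. -/
structure HasWhitneyJets (k : ℕ) (μ B r₀ : ℝ) (S : Set (EuclideanSpace ℝ (Fin n)))
    (p : EuclideanSpace ℝ (Fin n) → Fin Q → EuclideanSpace ℝ (Fin n) → EuclideanSpace ℝ (Fin m)) :
    Prop where
  isPolyMap : ∀ x i, IsPolyMap k (p x i)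
  nonneg : 0 ≤ B
  bound : ∀ x ∈ S, ∀ i, ∀ j ≤ k + 1, ∀ z ∈ closedBall x r₀, ‖iteratedFDeriv ℝ j (p x i) z‖ ≤ B
  close : ∀ x ∈ S, ∀ y ∈ S, x ≠ y → dist x y ≤ r₀ / 2 → ∃ σ : Equiv.Perm (Fin Q), ∀ i, ∀ j ≤ k,
    ‖iteratedFDeriv ℝ j (p y i) y - iteratedFDeriv ℝ j (p x (σ i)) y‖ ≤
      B * dist x y ^ (k + μ - j)

/-- The bound compares `p x` with the zero tuple on `ball x r₀`. The compatibility compares `p y`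
with `p x` through `u` on `ball y r`, `r = dist x y`, which lies in `ball x (2 * r)`. -/
theorem exists_hasWhitneyJets (n m Q k : ℕ) {q K r₀ : ℝ} (hq : 0 < q) (hK : 0 < K)
    (hr₀ : 0 < r₀) (hr₀1 : r₀ ≤ 1) :
    ∃ C : ℝ, 0 < C ∧ ∀ μ ∈ Ioo (0 : ℝ) 1, ∀ (U S : Set (EuclideanSpace ℝ (Fin n)))
      (u : EuclideanSpace ℝ (Fin n) → AQ Q (EuclideanSpace ℝ (Fin m)))
      (p : EuclideanSpace ℝ (Fin n) → Fin Q → EuclideanSpace ℝ (Fin n) →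
        EuclideanSpace ℝ (Fin m)) (M : ℝ), 0 ≤ M →
      AEStronglyMeasurable u (volume.restrict U) →
      ∫⁻ x in U, ENNReal.ofReal ((u x).mag ^ q) ≤ ENNReal.ofReal M →
      (∀ x i, IsPolyMap k (p x i)) → (∀ x ∈ S, ball x r₀ ⊆ U) →
      (∀ x ∈ S, ∀ σ, 0 < σ → σ ≤ r₀ → lqDist q u (AQ.sheets (p x)) (ball x σ) ≤
        ENNReal.ofReal (K * M * σ ^ decayExp n k q μ)) →
      HasWhitneyJets k μ (C * M ^ (1 / q)) r₀ S p := by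
  obtain ⟨C, hC, hpoly⟩ := exists_perm_polynomial_close n m Q k hq
  set e₁ := decayExp n k q 1
  set L₁ := 2 ^ q * (K + 1) / r₀ ^ n with hL₁
  set L₂ := 2 ^ q * (K * 2 ^ e₁ + K) with hL₂
  have hL₁0 : 0 < L₁ := by positivity
  have hL₂0 : 0 < L₂ := by positivity
  set C₁ := C * L₁ ^ (1 / q) / r₀ ^ (k + 1) with hC₁
  set C₂ := C * L₂ ^ (1 / q) with hC₂
  have hC₁0 : 0 < C₁ := by positivity
  have hC₂0 : 0 < C₂ := by positivity
  refine ⟨C₁ + C₂, by positivity, ?_⟩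
  rintro μ ⟨hμ0, hμ1⟩ U S u p M hM hu huM hp hSU hdec
  have hee : decayExp n k q μ ≤ e₁ := decayExp_le hq.le hμ1.le
  have he0 : 0 ≤ decayExp n k q μ := decayExp_nonneg hq.le hμ0.le
  have hmeas : ∀ s ⊆ U, AEStronglyMeasurable u (volume.restrict s) := fun s hs =>
    hu.mono_measure (Measure.restrict_mono hs le_rfl)
  have hmeasp : ∀ x s, AEStronglyMeasurable (AQ.sheets (p x)) (volume.restrict s) := fun x s =>
    (continuous_sheets (hp x)).aestronglyMeasurable
  have hMq : 0 ≤ M ^ (1 / q) := by positivity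
  refine ⟨hp, by positivity, fun x hx i j hj z hz => ?_, fun x hx y hy hxy hdist => ?_⟩
  · have h0 : lqDist q u (fun _ => AQ.mk fun _ => 0) (ball x r₀) ≤ ENNReal.ofReal M :=
      (lintegral_mono_set (hSU x hx)).trans huM
    have h1 : lqDist q (AQ.sheets (p x)) (fun _ => AQ.mk fun _ => 0) (ball x r₀) ≤
        ENNReal.ofReal (L₁ * M * r₀ ^ n) := by
      refine lqDist_triangle hq.le (hmeasp x _) (hmeas _ (hSU x hx))
        (by positivity : 0 ≤ K * M * r₀ ^ decayExp n k q μ) hM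
        (lqDist_comm.trans_le (hdec x hx r₀ hr₀ le_rfl)) h0 ?_
      have : r₀ ^ decayExp n k q μ ≤ 1 := Real.rpow_le_one hr₀.le hr₀1 he0
      calc 2 ^ q * (K * M * r₀ ^ decayExp n k q μ + M) ≤ 2 ^ q * (K * M * 1 + M) := by gcongr
        _ = L₁ * M * r₀ ^ n := by rw [hL₁]; field_simp
    obtain ⟨σ, hσ⟩ := hpoly (p x) (fun _ _ => 0) (hp x) (fun _ => isPolyMap_zero) x r₀
      (L₁ ^ (1 / q) * M ^ (1 / q)) hr₀ (by positivity) (h1.trans_eq (by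
        rw [← Real.mul_rpow hL₁0.le hM, ← Real.rpow_mul (by positivity),
          one_div_mul_cancel hq.ne', Real.rpow_one]))
    have h2 := (hσ i).2 j hj z hz
    have h3 : iteratedFDeriv ℝ j (fun _ : EuclideanSpace ℝ (Fin n) =>
        (0 : EuclideanSpace ℝ (Fin m))) z = 0 := by
      simp
    rw [h3, sub_zero] at h2
    have hpow : r₀ ^ (k + 1) ≤ r₀ ^ j := pow_le_pow_of_le_one hr₀.le hr₀1 hj
    calc _ ≤ C * (L₁ ^ (1 / q) * M ^ (1 / q)) / r₀ ^ j := h2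
      _ ≤ C * (L₁ ^ (1 / q) * M ^ (1 / q)) / r₀ ^ (k + 1) := by gcongr
      _ = C₁ * M ^ (1 / q) := by rw [hC₁]; ring
      _ ≤ _ := by gcongr; linarith
  · set r := dist x y with hr
    have hr0 : 0 < r := dist_pos.2 hxy
    have hsub : ball y r ⊆ ball x (2 * r) := ball_subset_ball' (by rw [dist_comm y x]; linarith)
    have hyU : ball y r ⊆ U := (ball_subset_ball (by linarith)).trans (hSU y hy)
    have h1 : lqDist q (AQ.sheets (p y)) (AQ.sheets (p x)) (ball y r) ≤
        ENNReal.ofReal (L₂ * M * r ^ decayExp n k q μ) := by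
      refine lqDist_triangle hq.le (hmeasp y _) (hmeas _ hyU)
        (by positivity : 0 ≤ K * M * r ^ decayExp n k q μ)
        (by positivity : 0 ≤ K * M * (2 * r) ^ decayExp n k q μ)
        (lqDist_comm.trans_le (hdec y hy r hr0 (by linarith)))
        ((lqDist_mono_set hsub).trans (hdec x hx (2 * r) (by positivity) (by linarith))) ?_
      have := mul_rpow_le_of_one_le one_le_two hr0.le hee
      calc 2 ^ q * (K * M * r ^ decayExp n k q μ + K * M * (2 * r) ^ decayExp n k q μ)
          ≤ 2 ^ q * (K * M * r ^ decayExp n k q μ +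
              K * M * (2 ^ e₁ * r ^ decayExp n k q μ)) := by gcongr
        _ = L₂ * M * r ^ decayExp n k q μ := by rw [hL₂]; ring
    obtain ⟨σ, hσ⟩ := hpoly (p y) (p x) (hp y) (hp x) y r
      ((L₂ * M) ^ (1 / q) * r ^ (k + μ)) hr0 (by positivity)
      (h1.trans_eq (by rw [rpow_mul_decay hq (by positivity) hr0]))
    refine ⟨σ, fun i j hj => ((hσ i).2 j (by omega) y (mem_closedBall_self hr0.le)).trans ?_⟩
    calc C * ((L₂ * M) ^ (1 / q) * r ^ (k + μ)) / r ^ j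
        = C₂ * M ^ (1 / q) * r ^ (k + μ - j) := by
          rw [Real.rpow_sub hr0, Real.rpow_natCast, Real.mul_rpow hL₂0.le hM, hC₂]; ring
      _ ≤ _ := by gcongr; linarith

/-! ### Whitney jets give `C^{k,μ}` -/

/-- The tuple of `j`-th derivatives at `x` of the sheets of `p x`. -/
def jetSheets (p : EuclideanSpace ℝ (Fin n) → Fin Q → EuclideanSpace ℝ (Fin n) →
    EuclideanSpace ℝ (Fin m)) (j : ℕ) (x : EuclideanSpace ℝ (Fin n)) :
    AQ Q (EuclideanSpace ℝ (Fin n) [×j]→L[ℝ] EuclideanSpace ℝ (Fin m)) :=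
  AQ.mk fun i => iteratedFDeriv ℝ j (p x i) x

theorem IsPolyMap.hasFDerivAt_iteratedFDeriv
    {f : EuclideanSpace ℝ (Fin n) → EuclideanSpace ℝ (Fin m)} (hf : IsPolyMap k f) (j : ℕ)
    (x : EuclideanSpace ℝ (Fin n)) :
    HasFDerivAt (iteratedFDeriv ℝ j f) (iteratedFDeriv ℝ (j + 1) f x).curryLeft x :=
  ((hf.contDiff (N := (⊤ : ℕ∞))).differentiable_iteratedFDeriv
    (by exact_mod_cast ENat.natCast_lt_top j) x).hasFDerivAt

theorem AQ.mag_mk_le {F : Type*} [NormedAddCommGroup F] {a : Fin Q → F} {t : ℝ}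
    (h : ∀ i, ‖a i‖ ≤ t) : (AQ.mk a).mag ≤ Q * t :=
  AQ.G_mk_le_mul 1 fun i => by simpa using h i

namespace HasWhitneyJets

variable {μ B r₀ : ℝ} {S : Set (EuclideanSpace ℝ (Fin n))}
  {p : EuclideanSpace ℝ (Fin n) → Fin Q → EuclideanSpace ℝ (Fin n) → EuclideanSpace ℝ (Fin m)}

theorem mag_jetSheets_le (h : HasWhitneyJets k μ B r₀ S p) (hr₀ : 0 < r₀)
    {x : EuclideanSpace ℝ (Fin n)} (hx : x ∈ S) {j : ℕ} (hj : j ≤ k) :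
    (jetSheets p j x).mag ≤ Q * B :=
  AQ.mag_mk_le fun i => h.bound x hx i j (by omega) x (mem_closedBall_self hr₀.le)

/-- Reduces every question about jets at a moving point `y` to the fixed smooth sheets `p x`, up to
the compatibility error. -/
theorem G_jetSheets_mk_le (h : HasWhitneyJets k μ B r₀ S p)
    {x y : EuclideanSpace ℝ (Fin n)} (hx : x ∈ S) (hy : y ∈ S) (hxy : x ≠ y)
    (hdist : dist x y ≤ r₀ / 2) {j : ℕ} (hj : j ≤ k)
    (T : Fin Q → EuclideanSpace ℝ (Fin n) [×j]→L[ℝ] EuclideanSpace ℝ (Fin m)) :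
    AQ.G (jetSheets p j y) (AQ.mk T) ≤
      ∑ i, ‖iteratedFDeriv ℝ j (p x i) y - T i‖ + Q * (B * dist x y ^ (k + μ - j)) := by
  obtain ⟨σ, hσ⟩ := h.close x hx y hy hxy hdist
  rw [add_comm]
  exact (AQ.G_triangle _ (AQ.mk fun i => iteratedFDeriv ℝ j (p x i) y) _).trans
    (add_le_add (AQ.G_mk_le_mul σ fun i => hσ i j hj) (AQ.G_mk_le_sum _ _ 1))

theorem continuousWithinAt_jetSheets (h : HasWhitneyJets k μ B r₀ S p) (hμ : 0 < μ)
    (hr₀ : 0 < r₀) {x : EuclideanSpace ℝ (Fin n)} (hx : x ∈ S) {j : ℕ} (hj : j ≤ k) :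
    ContinuousWithinAt (jetSheets p j) S x := by
  have hexp : 0 < k + μ - j := by
    have : (j : ℝ) ≤ k := by exact_mod_cast hj
    linarith
  rw [ContinuousWithinAt, tendsto_iff_dist_tendsto_zero]
  have hlim : Tendsto (fun y => ∑ i, ‖iteratedFDeriv ℝ j (p x i) y - iteratedFDeriv ℝ j (p x i) x‖
      + Q * (B * dist x y ^ (k + μ - j))) (𝓝[S] x) (𝓝 0) := by
    have hc : Continuous fun y => ∑ i,
        ‖iteratedFDeriv ℝ j (p x i) y - iteratedFDeriv ℝ j (p x i) x‖
        + Q * (B * dist x y ^ (k + μ - j)) := by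
      refine .add (continuous_finsetSum _ fun i _ => ?_) (.mul continuous_const
        (.mul continuous_const (.rpow_const (by fun_prop) fun _ => Or.inr hexp.le)))
      exact (((h.isPolyMap x i).contDiff (N := j)).continuous_iteratedFDeriv le_rfl).sub
        continuous_const |>.norm
    have := hc.tendsto x
    simp only [sub_self, norm_zero, Finset.sum_const_zero, dist_self,
      Real.zero_rpow hexp.ne', mul_zero, add_zero] at this
    exact this.mono_left nhdsWithin_le_nhds
  refine squeeze_zero' (Eventually.of_forall fun _ => dist_nonneg) ?_ hlim
  filter_upwards [self_mem_nhdsWithin,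
    mem_nhdsWithin_of_mem_nhds (closedBall_mem_nhds x (half_pos hr₀))] with y hy hyx
  rcases eq_or_ne x y with rfl | hne
  · simp [Real.zero_rpow hexp.ne']
  · exact h.G_jetSheets_mk_le hx hy hne (by rw [dist_comm]; exact hyx) hj _

/-- Near `x` the jets are those of the fixed polynomials `p x i`, differentiable in the usual sense,
up to an error of order `‖z‖ ^ (k + μ - j)`. This is `o(‖z‖)` because `j + 1 ≤ k` and `μ > 0`. -/
theorem hasQDerivAt_jetSheets (h : HasWhitneyJets k μ B r₀ S p) (hμ : 0 < μ) (hr₀ : 0 < r₀)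
    {x : EuclideanSpace ℝ (Fin n)} (hx : S ∈ 𝓝 x) {j : ℕ} (hj : j < k) :
    HasQDerivAt (jetSheets p j)
      ((jetSheets p (j + 1) x).map ContinuousMultilinearMap.curryLeft) x := by
  have hexp : 0 < k + μ - j - 1 := by
    have : (j + 1 : ℝ) ≤ k := by exact_mod_cast hj
    linarith
  refine ⟨fun i => iteratedFDeriv ℝ j (p x i) x,
    fun i => (iteratedFDeriv ℝ (j + 1) (p x i) x).curryLeft, rfl, rfl, ?_⟩
  have hlim : Tendsto (fun z : EuclideanSpace ℝ (Fin n) =>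
      ∑ i, ‖iteratedFDeriv ℝ j (p x i) (x + z) - iteratedFDeriv ℝ j (p x i) x -
        (iteratedFDeriv ℝ (j + 1) (p x i) x).curryLeft z‖ / ‖z‖ +
      Q * (B * ‖z‖ ^ (k + μ - j - 1))) (𝓝[≠] 0) (𝓝 0) := by
    have h1 : ∀ i ∈ (Finset.univ : Finset (Fin Q)), Tendsto (fun z : EuclideanSpace ℝ (Fin n) =>
        ‖iteratedFDeriv ℝ j (p x i) (x + z) - iteratedFDeriv ℝ j (p x i) x -
          (iteratedFDeriv ℝ (j + 1) (p x i) x).curryLeft z‖ / ‖z‖) (𝓝[≠] 0) (𝓝 0) := fun i _ =>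
      ((hasFDerivAt_iff_isLittleO_nhds_zero.1
        ((h.isPolyMap x i).hasFDerivAt_iteratedFDeriv j x)).norm_norm.tendsto_div_nhds_zero).mono_left
        nhdsWithin_le_nhds
    have h2 : Tendsto (fun z : EuclideanSpace ℝ (Fin n) =>
        Q * (B * ‖z‖ ^ (k + μ - j - 1))) (𝓝[≠] 0) (𝓝 0) := by
      have hc : Continuous fun z : EuclideanSpace ℝ (Fin n) =>
          Q * (B * ‖z‖ ^ (k + μ - j - 1)) :=
        .mul continuous_const (.mul continuous_const
          (.rpow_const continuous_norm fun _ => Or.inr hexp.le))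
      have := hc.tendsto 0
      simp only [norm_zero, Real.zero_rpow hexp.ne', mul_zero] at this
      exact this.mono_left nhdsWithin_le_nhds
    simpa using (tendsto_finsetSum _ h1).add h2
  refine squeeze_zero' (Eventually.of_forall fun z => div_nonneg (AQ.G_nonneg _ _) (norm_nonneg _))
    ?_ hlim
  have hS : ∀ᶠ z in 𝓝 (0 : EuclideanSpace ℝ (Fin n)), x + z ∈ S := by
    have : Tendsto (fun z => x + z) (𝓝 0) (𝓝 x) := by
      simpa using (continuous_const_add x).tendsto (0 : EuclideanSpace ℝ (Fin n))
    exact this hx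
  filter_upwards [self_mem_nhdsWithin, mem_nhdsWithin_of_mem_nhds hS,
    mem_nhdsWithin_of_mem_nhds (closedBall_mem_nhds 0 (half_pos hr₀))] with z hz hzS hzr
  have hz0 : 0 < ‖z‖ := norm_pos_iff.2 hz
  have hd : dist x (x + z) = ‖z‖ := by simp
  have key := h.G_jetSheets_mk_le (mem_of_mem_nhds hx) hzS (by simpa using hz)
    (by rw [hd]; simpa using hzr) hj.le
    fun i => iteratedFDeriv ℝ j (p x i) x + (iteratedFDeriv ℝ (j + 1) (p x i) x).curryLeft z
  rw [div_le_iff₀ hz0]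
  refine key.trans (le_of_eq ?_)
  rw [hd, add_mul, Finset.sum_mul]
  congr 1
  · refine Finset.sum_congr rfl fun i _ => ?_
    rw [div_mul_cancel₀ _ hz0.ne', sub_sub]
  · rw [Real.rpow_sub_one hz0.ne']
    field_simp

/-- For nearby points the compatibility error is joined to a Lipschitz bound for the `k`-th
derivative of the fixed sheets, which is why `bound` goes up to order `k + 1`. For distant points
the sup bound is enough, at the cost of the factor `4 / r₀`. -/
theorem G_jetSheets_le (h : HasWhitneyJets k μ B r₀ S p) (hμ : 0 < μ) (hμ1 : μ < 1)
    (hr₀ : 0 < r₀) (hr₀1 : r₀ ≤ 1) {x y : EuclideanSpace ℝ (Fin n)} (hx : x ∈ S) (hy : y ∈ S) :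
    AQ.G (jetSheets p k x) (jetSheets p k y) ≤ Q * (4 / r₀) * B * dist x y ^ μ := by
  have hB := h.nonneg
  rcases eq_or_ne x y with rfl | hne
  · have : AQ.G (jetSheets p k x) (jetSheets p k x) = 0 := dist_self (jetSheets p k x)
    rw [this]
    positivity
  have hr : 0 < dist x y := dist_pos.2 hne
  rcases le_or_gt (dist x y) (r₀ / 2) with hd | hd
  · have hle : dist x y ≤ dist x y ^ μ :=
      Real.self_le_rpow_of_le_one hr.le (by linarith) hμ1.le
    rw [AQ.G_comm]
    refine (h.G_jetSheets_mk_le hx hy hne hd le_rfl _).trans ?_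
    have h1 : ∀ i ∈ (Finset.univ : Finset (Fin Q)),
        ‖iteratedFDeriv ℝ k (p x i) y - iteratedFDeriv ℝ k (p x i) x‖ ≤ B * dist x y ^ μ := by
      intro i _
      have := (convex_closedBall x r₀).norm_image_sub_le_of_norm_hasFDerivWithin_le
        (fun z _ => ((h.isPolyMap x i).hasFDerivAt_iteratedFDeriv k z).hasFDerivWithinAt)
        (fun z hz => by
          rw [ContinuousMultilinearMap.curryLeft_norm]
          exact h.bound x hx i (k + 1) le_rfl z hz)
        (mem_closedBall_self hr₀.le) (show y ∈ closedBall x r₀ by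
          rw [mem_closedBall, dist_comm]; linarith)
      refine this.trans ?_
      rw [← dist_eq_norm, dist_comm y x]
      gcongr
    refine (add_le_add_left (Finset.sum_le_card_nsmul _ _ _ h1) _).trans ?_
    rw [Finset.card_univ, Fintype.card_fin, nsmul_eq_mul, add_sub_cancel_left]
    have h4 : 2 ≤ 4 / r₀ := by rw [le_div_iff₀ hr₀]; linarith
    calc Q * (B * dist x y ^ μ) + Q * (B * dist x y ^ μ) = Q * 2 * B * dist x y ^ μ := by ring
      _ ≤ _ := by gcongr
  · have h1 : AQ.G (jetSheets p k x) (jetSheets p k y) ≤ Q * B + Q * B := by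
      refine (AQ.G_triangle _ (AQ.mk fun _ => 0) _).trans (add_le_add
        (h.mag_jetSheets_le hr₀ hx le_rfl) ?_)
      rw [AQ.G_comm]
      exact h.mag_jetSheets_le hr₀ hy le_rfl
    have h2 : r₀ / 2 ≤ dist x y ^ μ := by
      rcases le_total (dist x y) 1 with h1 | h1
      · exact hd.le.trans (Real.self_le_rpow_of_le_one hr.le h1 hμ1.le)
      · have := Real.one_le_rpow h1 hμ.le
        linarith
    calc _ ≤ Q * B + Q * B := h1
      _ = Q * (4 / r₀) * B * (r₀ / 2) := by field_simp; ring
      _ ≤ _ := by gcongr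

theorem hasQDerivsOn (h : HasWhitneyJets k μ B r₀ S p) (hμ : 0 < μ) (hr₀ : 0 < r₀)
    {V : Set (EuclideanSpace ℝ (Fin n))} (hV : IsOpen V) (hVS : V ⊆ S) :
    HasQDerivsOn k (fun x => AQ.sheets (p x) x) (jetSheets p) V where
  zero_eq _ _ := rfl
  deriv _ hj _ hx := h.hasQDerivAt_jetSheets hμ hr₀ (mem_of_superset (hV.mem_nhds hx) hVS) hj

theorem memQHolder (h : HasWhitneyJets k μ B r₀ S p) (hμ : 0 < μ) (hμ1 : μ < 1)
    (hr₀ : 0 < r₀) (hr₀1 : r₀ ≤ 1) {V : Set (EuclideanSpace ℝ (Fin n))} (hV : IsOpen V)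
    (hVS : closure V ⊆ S) :
    MemQHolder k (NNReal.mk μ hμ.le) V fun x => AQ.sheets (p x) x := by
  have hB := h.nonneg
  refine ⟨jetSheets p, h.hasQDerivsOn hμ hr₀ hV (subset_closure.trans hVS),
    fun j hj x hx => (h.continuousWithinAt_jetSheets hμ hr₀ (hVS hx) hj).mono hVS,
    (Q * (4 / r₀) * B).toNNReal, fun x hx y hy => ?_⟩
  rw [edist_dist, edist_dist, NNReal.coe_mk, ENNReal.ofReal_rpow_of_nonneg dist_nonneg hμ.le]
  refine le_trans (ENNReal.ofReal_le_ofReal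
    (h.G_jetSheets_le hμ hμ1 hr₀ hr₀1 (hVS hx) (hVS hy))) ?_
  rw [ENNReal.ofReal_mul (by positivity)]
  rfl

theorem qHolderNorm_le (h : HasWhitneyJets k μ B r₀ S p) (hμ : 0 < μ) (hμ1 : μ < 1)
    (hr₀ : 0 < r₀) (hr₀1 : r₀ ≤ 1) {V : Set (EuclideanSpace ℝ (Fin n))} (hV : IsOpen V)
    (hVS : V ⊆ S) :
    qHolderNorm k (NNReal.mk μ hμ.le) V (fun x => AQ.sheets (p x) x) ≤
      ENNReal.ofReal ((k + 1) * Q * B + Q * (4 / r₀) * B) := by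
  have hB := h.nonneg
  refine (iInf₂_le (jetSheets p) (h.hasQDerivsOn hμ hr₀ hV hVS)).trans ?_
  rw [ENNReal.ofReal_add (by positivity) (by positivity)]
  refine add_le_add ?_ ?_
  · calc _ ≤ ∑ j ∈ Finset.range (k + 1), ENNReal.ofReal (Q * B) := by
          refine Finset.sum_le_sum fun j hj => iSup₂_le fun x hx => ENNReal.ofReal_le_ofReal ?_
          exact h.mag_jetSheets_le hr₀ (hVS hx) (by have := Finset.mem_range.1 hj; omega)
      _ = _ := by
        rw [Finset.sum_const, Finset.card_range, nsmul_eq_mul, mul_assoc,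
          ENNReal.ofReal_mul (p := (k : ℝ) + 1) (by positivity)]
        congr 1
        rw [← Nat.cast_add_one, ENNReal.ofReal_natCast]
  · refine iSup₂_le fun x hx => iSup₂_le fun y hy => iSup_le fun hxy => ENNReal.ofReal_le_ofReal ?_
    rw [div_le_iff₀ (Real.rpow_pos_of_pos (dist_pos.2 hxy) _)]
    exact h.G_jetSheets_le hμ hμ1 hr₀ hr₀1 (hVS hx) (hVS hy)

end HasWhitneyJets

/-! ### Agreement almost everywhere -/

namespace HasWhitneyJets

variable {μ B r₀ : ℝ} {S : Set (EuclideanSpace ℝ (Fin n))}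
  {p : EuclideanSpace ℝ (Fin n) → Fin Q → EuclideanSpace ℝ (Fin n) → EuclideanSpace ℝ (Fin m)}

theorem G_sheets_le (h : HasWhitneyJets k μ B r₀ S p)
    {x z : EuclideanSpace ℝ (Fin n)} (hx : x ∈ S) (hz : z ∈ S) (hxz : dist x z ≤ r₀ / 2) :
    AQ.G (AQ.sheets (p x) z) (AQ.sheets (p z) z) ≤ Q * (B * dist x z ^ (k + μ)) := by
  have hB := h.nonneg
  rcases eq_or_ne x z with rfl | hne
  · have : AQ.G (AQ.sheets (p x) x) (AQ.sheets (p x) x) = 0 := dist_self (AQ.sheets (p x) x)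
    rw [this]
    positivity
  obtain ⟨σ, hσ⟩ := h.close x hx z hz hne hxz
  rw [AQ.G_comm]
  refine AQ.G_mk_le_mul σ fun i => ?_
  have := hσ i 0 (Nat.zero_le k)
  rwa [← iteratedFDeriv_sub_apply (h.isPolyMap z i).contDiff.contDiffAt
    (h.isPolyMap x (σ i)).contDiff.contDiffAt, norm_iteratedFDeriv_zero, Nat.cast_zero,
    sub_zero] at this

theorem continuousOn_sheets (h : HasWhitneyJets k μ B r₀ S p) (hμ : 0 < μ) (hr₀ : 0 < r₀) :
    ContinuousOn (fun x => AQ.sheets (p x) x) S := by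
  intro x hx
  have hexp : 0 < k + μ := by positivity
  rw [ContinuousWithinAt, tendsto_iff_dist_tendsto_zero]
  have hlim : Tendsto (fun z => Q * (B * dist x z ^ (k + μ)) +
      dist (AQ.sheets (p x) z) (AQ.sheets (p x) x)) (𝓝[S] x) (𝓝 0) := by
    have hc : Continuous fun z => Q * (B * dist x z ^ (k + μ)) +
        dist (AQ.sheets (p x) z) (AQ.sheets (p x) x) :=
      .add (.mul continuous_const (.mul continuous_const
        (.rpow_const (by fun_prop) fun _ => Or.inr hexp.le)))
        ((continuous_sheets (h.isPolyMap x)).dist continuous_const)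
    have := hc.tendsto x
    simp only [dist_self, Real.zero_rpow hexp.ne', mul_zero, add_zero] at this
    exact this.mono_left nhdsWithin_le_nhds
  refine squeeze_zero' (Eventually.of_forall fun _ => dist_nonneg) ?_ hlim
  filter_upwards [self_mem_nhdsWithin,
    mem_nhdsWithin_of_mem_nhds (closedBall_mem_nhds x (half_pos hr₀))] with z hz hzx
  refine (dist_triangle _ (AQ.sheets (p x) z) _).trans (add_le_add ?_ le_rfl)
  rw [dist_comm]
  exact h.G_sheets_le hx hz (by rw [dist_comm]; exact hzx)

theorem mag_sheets_le (h : HasWhitneyJets k μ B r₀ S p) (hr₀ : 0 < r₀)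
    {x : EuclideanSpace ℝ (Fin n)} (hx : x ∈ S) : (AQ.sheets (p x) x).mag ≤ Q * B :=
  AQ.mag_mk_le fun i => by
    have := h.bound x hx i 0 (Nat.zero_le _) x (mem_closedBall_self hr₀.le)
    rwa [norm_iteratedFDeriv_zero] at this

/-- Replacing the frozen polynomial `p x` by the diagonal `z ↦ p z z` costs `dist x z ^ (k + μ)`
pointwise, so the decay rate is unchanged. -/
theorem lqDist_sheets_le (h : HasWhitneyJets k μ B r₀ S p) (hμ : 0 < μ) {q K s : ℝ}
    (hq : 0 < q) (hK : 0 ≤ K) {u : EuclideanSpace ℝ (Fin n) → AQ Q (EuclideanSpace ℝ (Fin m))}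
    {x : EuclideanSpace ℝ (Fin n)} (hs : 0 < s) (hsr : s ≤ r₀ / 2) (hx : ball x s ⊆ S)
    (hu : AEStronglyMeasurable u (volume.restrict (ball x s)))
    (hdec : lqDist q u (AQ.sheets (p x)) (ball x s) ≤
      ENNReal.ofReal (K * s ^ decayExp n k q μ)) :
    lqDist q u (fun x => AQ.sheets (p x) x) (ball x s) ≤ ENNReal.ofReal
      (2 ^ q * (K + (Q * B) ^ q * (volume (ball (0 : EuclideanSpace ℝ (Fin n)) 1)).toReal) *
        s ^ decayExp n k q μ) := by
  have hB := h.nonneg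
  have h1 : lqDist q (AQ.sheets (p x)) (fun x => AQ.sheets (p x) x) (ball x s) ≤ _ :=
    lqDist_ball_le_of_forall_le (B := Q * B * s ^ (k + μ)) hq.le hs (by positivity) fun z hz => by
      have hxz : dist x z ≤ s := by rw [dist_comm]; exact (mem_ball.1 hz).le
      refine (h.G_sheets_le (hx (mem_ball_self hs)) (hx hz) (hxz.trans hsr)).trans ?_
      rw [← mul_assoc]
      gcongr
  refine lqDist_triangle hq.le hu
    (continuous_sheets (h.isPolyMap x)).aestronglyMeasurable (by positivity) (by positivity)
    hdec h1 (le_of_eq ?_)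
  have h2 := rpow_mul_decay (n := n) (k := k) (μ := μ) hq zero_le_one hs
  rw [Real.one_rpow, one_mul, one_mul] at h2
  rw [Real.mul_rpow (by positivity) (by positivity), ← h2]
  ring

/-- Lebesgue differentiation: almost everywhere `𝒢(u, w)^q` is the limit of its averages over small
balls, and the decay makes these `O(s ^ (k * q + q * μ))`. The exponent is positive even for `k =
0`. -/
theorem ae_eq_sheets (h : HasWhitneyJets k μ B r₀ S p) (hμ : 0 < μ) (hr₀ : 0 < r₀) {q K I : ℝ}
    (hq : 0 < q) (hK : 0 ≤ K) (hI : 0 ≤ I)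
    {u : EuclideanSpace ℝ (Fin n) → AQ Q (EuclideanSpace ℝ (Fin m))}
    {V : Set (EuclideanSpace ℝ (Fin n))} (hV : IsOpen V) (hVS : V ⊆ S) (hVfin : volume V ≠ ∞)
    (hu : AEStronglyMeasurable u (volume.restrict V))
    (huI : ∫⁻ x in V, ENNReal.ofReal ((u x).mag ^ q) ≤ ENNReal.ofReal I)
    (hdec : ∀ x ∈ V, ∀ s, 0 < s → s ≤ r₀ → lqDist q u (AQ.sheets (p x)) (ball x s) ≤
      ENNReal.ofReal (K * s ^ decayExp n k q μ)) :
    u =ᵐ[volume.restrict V] fun x => AQ.sheets (p x) x := by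
  have hB := h.nonneg
  set w := fun x => AQ.sheets (p x) x with hw
  have hwm : AEStronglyMeasurable w (volume.restrict V) :=
    ((h.continuousOn_sheets hμ hr₀).mono hVS).aestronglyMeasurable hV.measurableSet
  set f : EuclideanSpace ℝ (Fin n) → ℝ≥0∞ :=
    V.indicator fun x => ENNReal.ofReal (AQ.G (u x) (w x) ^ q) with hf
  have hfm : AEMeasurable f volume :=
    (aemeasurable_indicator_iff hV.measurableSet).2 (aemeasurable_rpow_G hu hwm)
  have hfin : ∫⁻ x, f x ≠ ∞ := by
    rw [hf, lintegral_indicator hV.measurableSet]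
    have h0 : lqDist q (fun _ => AQ.mk fun _ => 0) w V ≤
        ENNReal.ofReal ((Q * B) ^ q * (volume V).toReal) := by
      rw [ENNReal.ofReal_mul (by positivity), ENNReal.ofReal_toReal hVfin, ← setLIntegral_const]
      refine setLIntegral_mono measurable_const fun z hz => ENNReal.ofReal_le_ofReal ?_
      refine Real.rpow_le_rpow (AQ.G_nonneg _ _) ?_ hq.le
      rw [AQ.G_comm]
      exact h.mag_sheets_le hr₀ (hVS hz)
    exact ((lqDist_triangle hq.le hu aestronglyMeasurable_const hI (by positivity) huI h0
      le_rfl).trans_lt ENNReal.ofReal_lt_top).ne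
  -- The factor `2 ^ decayExp n k q μ` pays for enclosing the closed balls of the Besicovitch family
  -- in open balls of twice the radius.
  set L := 2 ^ q * (K + (Q * B) ^ q * (volume (ball (0 : EuclideanSpace ℝ (Fin n)) 1)).toReal) *
    2 ^ decayExp n k q μ
  set v := (volume (ball (0 : EuclideanSpace ℝ (Fin n)) 1)).toReal with hv
  have hv0 : 0 < v := ENNReal.toReal_pos (measure_ball_pos _ _ one_pos).ne' measure_ball_lt_top.ne
  have hexp : 0 < k * q + q * μ := by positivity
  rw [Filter.EventuallyEq, ae_restrict_iff' hV.measurableSet]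
  filter_upwards [(Besicovitch.vitaliFamily
    (volume : Measure (EuclideanSpace ℝ (Fin n)))).ae_tendsto_lintegral_div hfm hfin] with x hx hxV
  have hx1 := hx.comp (Besicovitch.tendsto_filterAt volume x)
  obtain ⟨η, hη, hηV⟩ := Metric.isOpen_iff.1 hV x hxV
  have hx2 : Tendsto ((fun a => (∫⁻ y in a, f y) / volume a) ∘ fun r => closedBall x r)
      (𝓝[>] 0) (𝓝 0) := by
    have hlim : Tendsto (fun s : ℝ => ENNReal.ofReal (L / v * s ^ (k * q + q * μ)))
        (𝓝[>] 0) (𝓝 0) := by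
      have hc : Continuous fun s : ℝ => ENNReal.ofReal (L / v * s ^ (k * q + q * μ)) :=
        ENNReal.continuous_ofReal.comp
          (.mul continuous_const (.rpow_const continuous_id fun _ => Or.inr hexp.le))
      have := hc.tendsto 0
      rw [Real.zero_rpow hexp.ne', mul_zero, ENNReal.ofReal_zero] at this
      exact this.mono_left nhdsWithin_le_nhds
    refine tendsto_of_tendsto_of_tendsto_of_le_of_le' tendsto_const_nhds hlim
      (Eventually.of_forall fun _ => zero_le) ?_
    have hs1 : ∀ᶠ s : ℝ in 𝓝[>] 0, s < min (r₀ / 4) (η / 2) :=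
      nhdsWithin_le_nhds (Iio_mem_nhds (by positivity))
    filter_upwards [self_mem_nhdsWithin, hs1] with s hs hsm
    rw [mem_Ioi] at hs
    have hsr : s < r₀ / 4 := hsm.trans_le (min_le_left _ _)
    have hsη : s < η / 2 := hsm.trans_le (min_le_right _ _)
    have hsV : ball x (2 * s) ⊆ V := (ball_subset_ball (by linarith)).trans hηV
    have h1 := h.lqDist_sheets_le hμ hq hK (by positivity : 0 < 2 * s) (by linarith)
      (hsV.trans hVS) (hu.mono_measure (Measure.restrict_mono hsV le_rfl))
      (hdec x hxV (2 * s) (by positivity) (by linarith))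
    have h2 : ∫⁻ y in closedBall x s, f y ≤ ENNReal.ofReal (L * s ^ decayExp n k q μ) := by
      calc ∫⁻ y in closedBall x s, f y
          ≤ ∫⁻ y in ball x (2 * s), f y :=
            lintegral_mono_set (closedBall_subset_ball (by linarith))
        _ ≤ lqDist q u w (ball x (2 * s)) := lintegral_mono (indicator_le_self _ _)
        _ ≤ _ := h1
        _ = _ := by
          rw [Real.mul_rpow (by norm_num) hs.le, ← mul_assoc]
    have h3 : ENNReal.ofReal (s ^ n * v) ≤ volume (closedBall x s) := by
      rw [hv, ← volume_ball_eq x hs]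
      exact measure_mono ball_subset_closedBall
    calc (∫⁻ y in closedBall x s, f y) / volume (closedBall x s)
        ≤ ENNReal.ofReal (L * s ^ decayExp n k q μ) / ENNReal.ofReal (s ^ n * v) :=
          ENNReal.div_le_div h2 h3
      _ = ENNReal.ofReal (L / v * s ^ (k * q + q * μ)) := by
        rw [← ENNReal.ofReal_div_of_pos (by positivity)]
        congr 1
        rw [decayExp, add_assoc, Real.rpow_add hs, Real.rpow_natCast]
        field_simp
  have h0 : f x = 0 := tendsto_nhds_unique hx1 hx2
  rw [hf, indicator_of_mem hxV, ENNReal.ofReal_eq_zero] at h0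
  have hG : AQ.G (u x) (w x) = 0 := by
    by_contra hne
    exact absurd h0 (not_le.2 (Real.rpow_pos_of_pos
      ((AQ.G_nonneg _ _).lt_of_ne' hne) q))
  exact eq_of_dist_eq_zero hG

end HasWhitneyJets

/-! ### Reduction of the hypotheses to the decay structure, and the main theorem. -/

theorem ball_subset_of_mem_closure {E : Type*} [MetricSpace E] {S T : Set E} {x : E}
    (hx : x ∈ closure S) : ball x (setDist S Tᶜ) ⊆ T := by
  intro z hz
  by_contra hzT
  obtain ⟨y, hy, hxy⟩ := Metric.mem_closure_iff.1 hx (setDist S Tᶜ - dist z x) (sub_pos.2 hz)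
  have h1 : setDist S Tᶜ ≤ dist y z :=
    csInf_le ⟨0, by rintro _ ⟨_, _, _, _, rfl⟩; exact dist_nonneg⟩ ⟨y, hy, z, hzT, rfl⟩
  have h2 := dist_triangle y x z
  rw [dist_comm y x, dist_comm x z] at h2
  linarith

/-- Multiplying by `σ ^ (n + k * q)` turns the scale-invariant form of (I) and (II) into a plain
decay of exponent `n + kq + qμ`. -/
theorem le_of_rescaled_le {q μ b σ ρ : ℝ} {X Y : ℝ≥0∞} (hσ : 0 < σ) (hρ : 0 < ρ)
    (h : ENNReal.ofReal (σ ^ (-(n : ℝ) - k * q)) * X ≤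
      ENNReal.ofReal (b * (σ / ρ) ^ (q * μ) * ρ ^ (-(n : ℝ) - k * q)) * Y) :
    X ≤ ENNReal.ofReal (b * (σ / ρ) ^ decayExp n k q μ) * Y := by
  have h1 : σ ^ (n + k * q) * σ ^ (-(n : ℝ) - k * q) = 1 := by
    rw [← Real.rpow_add hσ, ← Real.rpow_zero σ]
    congr 1
    ring
  have h2 : σ ^ (n + k * q) * (b * (σ / ρ) ^ (q * μ) * ρ ^ (-(n : ℝ) - k * q)) =
      b * (σ / ρ) ^ decayExp n k q μ := by
    rw [decayExp, Real.rpow_add (x := σ / ρ) (by positivity), Real.div_rpow hσ.le hρ.le (n + k * q),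
      ← neg_add', Real.rpow_neg hρ.le]
    ring
  have h3 := mul_le_mul_right h (ENNReal.ofReal (σ ^ (n + k * q)))
  rwa [← mul_assoc, ← mul_assoc, ← ENNReal.ofReal_mul (by positivity),
    ← ENNReal.ofReal_mul (by positivity), h1, h2, ENNReal.ofReal_one, one_mul] at h3

end

theorem mainTheorem5
    (n m Q k : ℕ) (hn : 1 ≤ n) (hm : 1 ≤ m) (hQ : 1 ≤ Q)
    (q A β₁ β₂ ε δ : ℝ) (hq : 1 ≤ q) (hA : 0 < A) (hβ₁ : 0 < β₁) (hβ₂ : 0 < β₂)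
    (hε : ε ∈ Set.Ioo (0 : ℝ) (1 / 4)) (hδ : 0 < δ) :
    -- the constant does not depend on `μ`; the Hölder exponent may
    ∃ C : ℝ, 0 < C ∧ ∀ μ ∈ Set.Ioo (0 : ℝ) 1, ∃ lam : ℝ≥0, 0 < lam ∧ lam < 1 ∧
      ∀ (Ω Ω' Ω'' Γ : Set (EuclideanSpace ℝ (Fin n)))
        (u : EuclideanSpace ℝ (Fin n) → AQ Q (EuclideanSpace ℝ (Fin m)))
        (P : EuclideanSpace ℝ (Fin n) →
          EuclideanSpace ℝ (Fin n) → AQ Q (EuclideanSpace ℝ (Fin m)))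
        (β : ℝ), 0 < β →
        -- the domains and the bad set
        IsOpen Ω → Convex ℝ Ω →
        IsOpen Ω'' → closure Ω' ⊆ Ω'' → closure Ω'' ⊆ Ω → IsCompact (closure Ω'') →
        Convex ℝ Ω' → IsWeightedDomain A Ω' →
        setDist Ω' Ω''ᶜ = δ →
        IsClosed Γ → Γ ⊆ closure Ω → (Γ ∩ closure Ω'').Nonempty →
        -- the function
        AEStronglyMeasurable u (volume.restrict Ω) →
        (∫⁻ x in Ω'', ENNReal.ofReal ((u x).mag ^ q)) < ∞ →
        -- the polynomials
        (∀ x₀ ∈ closure Ω'', IsQPoly k (P x₀)) →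
        (∀ x₀ ∈ Γ ∩ closure Ω'', ∀ x ∈ Ω, (P x₀ x).mag ≤ β) →
        -- (I)
        (∀ x₀ ∈ Γ ∩ closure Ω'', ∀ σ ρ : ℝ, 0 < σ → σ ≤ ρ / 2 → ρ / 2 ≤ ε / 2 →
          ENNReal.ofReal (σ ^ (-(n : ℝ) - k * q)) *
              (∫⁻ x in ball x₀ σ ∩ Ω, ENNReal.ofReal (AQ.G (u x) (P x₀ x) ^ q)) ≤
            ENNReal.ofReal (β₁ * (σ / ρ) ^ (q * μ) * ρ ^ (-(n : ℝ) - k * q)) *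
              (∫⁻ x in ball x₀ ρ ∩ Ω, ENNReal.ofReal (AQ.G (u x) (P x₀ x) ^ q))) →
        -- (II)
        (∀ x₀ ∈ closure Ω'' \ Γ, ∀ y ∈ Γ ∩ closure Ω'', ∀ σ ρ : ℝ,
          0 < σ → σ ≤ ρ / 2 → ρ / 2 < 1 / 2 * min (1 / 4) (infDist x₀ Γ) →
          ENNReal.ofReal (σ ^ (-(n : ℝ) - k * q)) *
              (∫⁻ x in ball x₀ σ ∩ Ω, ENNReal.ofReal (AQ.G (u x) (P x₀ x) ^ q)) ≤
            ENNReal.ofReal (β₂ * (σ / ρ) ^ (q * μ) * ρ ^ (-(n : ℝ) - k * q)) *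
              (∫⁻ x in ball x₀ ρ ∩ Ω, ENNReal.ofReal (AQ.G (u x) (P y x) ^ q))) →
        ∃ w : EuclideanSpace ℝ (Fin n) → AQ Q (EuclideanSpace ℝ (Fin m)),
          u =ᵐ[volume.restrict Ω'] w ∧ MemQHolder k lam Ω' w ∧
          qHolderNorm k lam Ω' w ≤
            ENNReal.ofReal C *
              (ENNReal.ofReal (β ^ q) +
                ∫⁻ x in Ω'', ENNReal.ofReal ((u x).mag ^ q)) ^ (1 / q) := by
  have hq0 : 0 < q := one_pos.trans_le hq
  obtain ⟨K, r₀, hK, hr₀, hr₀4, hr₀δ, hdec⟩ :=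
    exists_uniform_decay n m Q k (ε := ε) hq0 hβ₁ hβ₂ hε.1 hε.2 hδ
  obtain ⟨C, hC, hjets⟩ := exists_hasWhitneyJets n m Q k hq0 hK hr₀ (by linarith)
  have hQ0 : (0 : ℝ) < Q := by exact_mod_cast hQ
  -- `k + 1` sup norms and one Hölder seminorm, each proportional to the jet bound `C * M ^ (1 /
  -- q)`.
  refine ⟨((k + 1) * Q + Q * (4 / r₀)) * C, by positivity, fun μ hμ =>
    ⟨NNReal.mk μ hμ.1.le, hμ.1, hμ.2, ?_⟩⟩
  intro Ω Ω' Ω'' Γ u P β hβ hΩ _ hΩ'' hΩ'Ω'' hΩ''Ω hcpt _ hΩ' hdist hΓ _ hΓne hu huq hP hPβ hI hII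
  have hsub : Ω'' ⊆ Ω := subset_closure.trans hΩ''Ω
  -- An ordering of the sheets is fixed at every point, with zero sheets outside `closure Ω''`; no
  -- regularity of this choice in `x` is needed.
  have hex : ∀ x, ∃ f : Fin Q → EuclideanSpace ℝ (Fin n) → EuclideanSpace ℝ (Fin m),
      (∀ i, IsPolyMap k (f i)) ∧ (x ∈ closure Ω'' → P x = AQ.sheets f) := by
    intro x
    by_cases hx : x ∈ closure Ω''
    · obtain ⟨c, hc, hPc⟩ := hP x hx
      exact ⟨fun i z => WithLp.toLp 2 fun j => MvPolynomial.eval (fun l => z l) (c i j),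
        fun i => ⟨c i, hc i, fun _ => rfl⟩, fun _ => funext hPc⟩
    · exact ⟨fun _ _ => 0, fun _ => isPolyMap_zero, fun h => absurd h hx⟩
  choose p hp hPp using hex
  set J := ∫⁻ x in Ω'', ENNReal.ofReal ((u x).mag ^ q) with hJ
  have hJI : J = ENNReal.ofReal J.toReal := (ENNReal.ofReal_toReal huq.ne).symm
  have hJ0 : 0 ≤ J.toReal := ENNReal.toReal_nonneg
  have hβq : 0 ≤ β ^ q := by positivity
  have hum : AEStronglyMeasurable u (volume.restrict Ω'') :=
    hu.mono_measure (Measure.restrict_mono hsub le_rfl)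
  have hball : ∀ (x : EuclideanSpace ℝ (Fin n)) (r : ℝ), ball x r ⊆ Ω'' → ball x r ∩ Ω = ball x r :=
    fun x r h => inter_eq_left.2 (h.trans hsub)
  have hdecay : HasQPolyDecay k q β₁ β₂ ε μ Ω'' Γ u p β J.toReal :=
    { isClosed := hΓ
      nonempty := hΓne
      aestronglyMeasurable := hum
      nonneg := hJ0
      lintegral_le := hJI.le
      isPolyMap := hp
      mag_le := fun x₀ hx₀ x hx => by
        rw [← hPp x₀ hx₀.2]
        exact hPβ x₀ hx₀ x (hsub hx)
      decay_mem := fun x₀ hx₀ σ ρ hσ hσρ hρ hx => by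
        have hσx : ball x₀ σ ⊆ Ω'' := (ball_subset_ball (by linarith)).trans hx
        have := hI x₀ hx₀ σ ρ hσ hσρ (by linarith)
        rw [hball x₀ σ hσx, hball x₀ ρ hx] at this
        rw [← hPp x₀ hx₀.2]
        exact le_of_rescaled_le hσ (by linarith) this
      decay_notMem := fun x₀ hx₀ y hy σ ρ hσ hσρ hρ4 hρd hx => by
        have hσx : ball x₀ σ ⊆ Ω'' := (ball_subset_ball (by linarith)).trans hx
        have hx₀' : x₀ ∈ closure Ω'' := subset_closure hx₀.1
        have := hII x₀ ⟨hx₀', hx₀.2⟩ y hy σ ρ hσ hσρ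
          (by linarith [lt_min hρ4 hρd])
        rw [hball x₀ σ hσx, hball x₀ ρ hx] at this
        rw [← hPp x₀ hx₀', ← hPp y hy.2]
        exact le_of_rescaled_le hσ (by linarith) this }
  set M := β ^ q + J.toReal with hM
  have hM0 : 0 ≤ M := by positivity
  -- This set contains `closure Ω'`, so the jets are defined and Hölder up to the boundary and
  -- nothing has to be extended.
  set S : Set (EuclideanSpace ℝ (Fin n)) := {x | ball x δ ⊆ Ω''} with hS
  have hS' : closure Ω' ⊆ S := fun x hx => by
    have := ball_subset_of_mem_closure (T := Ω'') hx
    rwa [hdist] at this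
  have hdecS : ∀ x ∈ S, ∀ σ, 0 < σ → σ ≤ r₀ → lqDist q u (AQ.sheets (p x)) (ball x σ) ≤
      ENNReal.ofReal (K * M * σ ^ decayExp n k q μ) :=
    hdec μ hμ Ω'' Γ u p β J.toReal hβ hdecay
  have hW : HasWhitneyJets k μ (C * M ^ (1 / q)) r₀ S p :=
    hjets μ hμ Ω'' S u p M hM0 hum (hJI.le.trans (ENNReal.ofReal_le_ofReal (by linarith))) hp
      (fun x hx => (ball_subset_ball hr₀δ.le).trans hx) hdecS
  have hΩ'sub : Ω' ⊆ Ω'' := subset_closure.trans hΩ'Ω''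
  have hΩ'S : Ω' ⊆ S := subset_closure.trans hS'
  refine ⟨fun x => AQ.sheets (p x) x, ?_, ?_, ?_⟩
  · exact hW.ae_eq_sheets hμ.1 hr₀ hq0 (by positivity) hJ0 hΩ'.isOpen hΩ'S
      hΩ'.isBounded.measure_lt_top.ne
      (hum.mono_measure (Measure.restrict_mono hΩ'sub le_rfl))
      ((lintegral_mono_set hΩ'sub).trans hJI.le) fun x hx => hdecS x (hΩ'S hx)
  · exact hW.memQHolder hμ.1 hμ.2 hr₀ (by linarith) hΩ'.isOpen hS'
  · refine (hW.qHolderNorm_le hμ.1 hμ.2 hr₀ (by linarith) hΩ'.isOpen hΩ'S).trans (le_of_eq ?_)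
    rw [hJI, ← ENNReal.ofReal_add hβq hJ0, ENNReal.ofReal_rpow_of_nonneg hM0 (by positivity),
      ← ENNReal.ofReal_mul (by positivity)]
    congr 1
    ring
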